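/- **Setting.** Let $\widehat\Omega=(0,1)^3$ and let $p_l>r_l\ge 1$ (so $p_l\ge 2$) be integers, $l=1,2,3$. For each $l$ let $\Xi_l=\{\xi^l_1\le\dots\le\xi^l_{n_l+p_l+1}\}$ be a $p_l$-open knot vector, i.e. $\xi^l_1=\dots=\xi^l_{p_l+1}=0$ and $\xi^l_{n_l+1}=\dots=\xi^l_{n_l+p_l+1}=1$, whose internal knots $\xi^l_{p_l+2},\dots,\xi^l_{n_l}$ have multiplicity at most $p_l-r_l$. The mesh is assumed regular with constant $c_u$: for each $l$, any two non-empty knot intervals $(\xi^l_i,\xi^l_{i+1})$, $(\xi^l_k,\xi^l_{k+1})$ satisfy $\xi^l_{k+1}-\xi^l_k\le c_u(\xi^l_{i+1}-\xi^l_i)$. **Univariate projections.** For one knot vector $\Xi$ of degree $p$ let $B_{j,p}$ ($1\le j\le n$) be the B-splines given by the Cox–de Boor recursion, and let $\lambda_j^p$ be the (Schumaker) dual functionals $$\lambda^p_j(f)=\int_{\xi_j}^{\xi_{j+p+1}} f\,\frac{d^{p+1}}{dx^{p+1}}\psi_j\,dx,\qquad \psi_j(x)=g_p\Big(\frac{2x-\xi_j-\xi_{j+p+1}}{\xi_{j+p+1}-\xi_j}\Big)\,\frac{(x-\xi_{j+1})\cdots(x-\xi_{j+p})}{p!},$$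 where $g_p(x)=\int_{-1}^x \frac{p+1}{2}N_p(t)\,dt$ and $N_p$ is the Cox–de Boor B-spline of degree $p$ with the knots $-\cos(i\pi/(p+1))$, $0\le i\le p+1$. They satisfy $\lambda^p_i(B_{j,p})=\delta_{ij}$. For $v\in L^2(0,1)$ put $$\widehat\Pi_p v=\sum_{j=1}^n \lambda^p_j(v)B_{j,p},\qquad \widehat\Pi^{c,1}_{p-1}v=\frac{d}{dx}\widehat\Pi_p\int_0^x v,\qquad \widehat\Pi^{c,2}_{p-2}v=\frac{d}{dx}\widehat\Pi^{c,1}_{p-1}\int_0^x v .$$ **Projections on $\widehat\Omega$.** For $a\in\{0,1,2\}^3$ let $\Pi_{a_1a_2a_3}=P_1\otimes P_2\otimes P_3$, where $P_l$ acts in the $l$-th coordinate and is $\widehat\Pi_{p_l}$, $\widehat\Pi^{c,1}_{p_l-1}$ or $\widehat\Pi^{c,2}_{p_l-2}$ (for the knot vector $\Xi_l$) according as $a_l=0,1,2$. For scalar $\phi$, $3\times3$-matrix valued $S,T$ and vector valued $v$ set $\widehat\Pi^1_h\phi=\Pi_{000}\phi$, $$\widehat\Pi^2_hS=\begin{pmatrix}s_1&s_2&s_3\\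 s_2&s_4&s_5\\ s_3&s_5&s_6\end{pmatrix},\quad \begin{aligned}s_1&=\Pi_{200}S_{11}, & s_2&=\Pi_{110}S_{12}, & s_3&=\Pi_{101}S_{13},\\ s_4&=\Pi_{020}S_{22}, & s_5&=\Pi_{011}S_{23}, & s_6&=\Pi_{002}S_{33},\end{aligned}$$ $$\widehat\Pi^3_hT=\begin{pmatrix}\Pi_{111}T_{11}&\Pi_{201}T_{12}&\Pi_{210}T_{13}\\ \Pi_{021}T_{21}&\Pi_{111}T_{22}&\Pi_{120}T_{23}\\ \Pi_{012}T_{31}&\Pi_{102}T_{32}&\Pi_{111}T_{33}\end{pmatrix},\quad \widehat\Pi^4_hv=\begin{pmatrix}\Pi_{211}v_1\\ \Pi_{121}v_2\\ \Pi_{112}v_3\end{pmatrix}.$$ **Lemma (stability of the projections).** There is a constant $C$, depending only on $p_l,r_l$ $(l=1,2,3)$ and $c_u$, such that for all knot vectors $\Xi_1,\Xi_2,\Xi_3$ as above and every mesh element $K=\prod_{l=1}^3(\xi^l_{j_l},\xi^l_{j_l+1})\neq\emptyset$ with support extension $\tilde K=\prod_{l=1}^3(\xi^l_{j_l-p_l},\xi^l_{j_l+p_l+1})$,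 the projections below are in $L^2(K)$ and $$\|\widehat\Pi^1_h\phi\|_{L^2(K)}\le C\|\phi\|_{L^2(\tilde K)},\quad \|\widehat\Pi^2_hS\|_{L^2(K)}\le C\|S\|_{L^2(\tilde K)},\quad \|\widehat\Pi^3_hT\|_{L^2(K)}\le C\|T\|_{L^2(\tilde K)},\quad \|\widehat\Pi^4_hv\|_{L^2(K)}\le C\|v\|_{L^2(\tilde K)}$$ for all scalar $\phi$, matrix valued $S,T$ and vector valued $v$ with components in $L^2(\widehat\Omega)$. Here $\|\cdot\|^2_{L^2}$ of a vector or matrix function is the sum of the squares of the $L^2$ norms of its components. -/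

import Mathlib

open MeasureTheory Set
open scoped ENNReal NNReal

namespace SplineHessian

noncomputable section

/-! ### Univariate B-splines -/

/-- The B-spline `B_{j,p}` of degree `p` for the knots `ξ_j ≤ … ≤ ξ_{j+p+1}` (indices start at `0`),
by the Cox–de Boor recursion. Division by zero is zero in Lean, which is the convention `0/0 = 0`. -/
def bspline (ξ : ℕ → ℝ) : ℕ → ℕ → ℝ → ℝ
  | 0, j, x => (Ico (ξ j) (ξ (j + 1))).indicator (fun _ => (1 : ℝ)) x
  | p + 1, j, x =>
      (x - ξ j) / (ξ (j + p + 1) - ξ j) * bspline ξ p j x +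
        (ξ (j + p + 2) - x) / (ξ (j + p + 2) - ξ (j + 1)) * bspline ξ p (j + 1) x

/-- A `p`-open knot vector `0 = ξ_0 = … = ξ_p ≤ … ≤ ξ_n = … = ξ_{n+p} = 1`, so that there are
`n + p + 1` knots and `n` B-splines of degree `p`. The sequence is padded by `1` beyond the
index `n + p`; the padding enters no B-spline `B_{j,p}` with `j < n`. -/
structure OpenKnots (p : ℕ) where
  n : ℕ
  knot : ℕ → ℝ
  mono : Monotone knot
  knot_start : ∀ i, i ≤ p → knot i = 0
  knot_end : ∀ i, n ≤ i → knot i = 1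

namespace OpenKnots

variable {p : ℕ}

/-- The multiplicity of the value `ξ_j` in the knot vector. -/
def multiplicity (Ξ : OpenKnots p) (j : ℕ) : ℕ :=
  ((Finset.range (Ξ.n + p + 1)).filter (fun i => Ξ.knot i = Ξ.knot j)).card

/-- All internal knots have multiplicity at most `p - r`: the splines of degree `p` are `C^r`. -/
def HasRegularity (Ξ : OpenKnots p) (r : ℕ) : Prop :=
  ∀ j, p < j → j < Ξ.n → Ξ.multiplicity j + r ≤ p

/-- `(ξ_i, ξ_{i+1})` is an element of the univariate mesh. These are exactly the intervals between
consecutive breakpoints, each listed once. -/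
def IsElement (Ξ : OpenKnots p) (i : ℕ) : Prop :=
  Ξ.knot i < Ξ.knot (i + 1)

/-- Regular mesh: the largest element is at most `c` times as long as any element. -/
def IsRegular (Ξ : OpenKnots p) (c : ℝ) : Prop :=
  ∀ i k, Ξ.IsElement i → Ξ.IsElement k →
    Ξ.knot (k + 1) - Ξ.knot k ≤ c * (Ξ.knot (i + 1) - Ξ.knot i)

end OpenKnots

/-! ### The dual functionals -/

/-- The extremal points `-cos (iπ/m)`, `0 ≤ i ≤ m`, of the Chebyshev polynomial of degree `m`,
in increasing order. -/
def chebyshevKnot (m i : ℕ) : ℝ :=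
  -Real.cos (i * Real.pi / m)

/-- The transition function of order `p + 1`: the primitive of the perfect B-spline of degree `p`,
i.e. of the B-spline with the `p + 2` Chebyshev knots in `[-1, 1]`, scaled to have integral one.
It is `0` left of `-1` and `1` right of `1`. -/
def transition (p : ℕ) (x : ℝ) : ℝ :=
  ∫ t in (-1 : ℝ)..x, ((p + 1 : ℝ) / 2) * bspline (chebyshevKnot (p + 1)) p 0 t

/-- `ψ_j = G_j φ_j`, where `φ_j(x) = (x - ξ_{j+1}) ⋯ (x - ξ_{j+p}) / p!` and `G_j` is the transition
function transported from `[-1, 1]` to the support `[ξ_j, ξ_{j+p+1}]` of `B_{j,p}`. -/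
def dualKernel (ξ : ℕ → ℝ) (p j : ℕ) (x : ℝ) : ℝ :=
  transition p ((2 * x - ξ j - ξ (j + p + 1)) / (ξ (j + p + 1) - ξ j)) *
    ((∏ k ∈ Finset.range p, (x - ξ (j + k + 1))) / (p.factorial : ℝ))

/-- The dual functional `λ_j^p f = ∫ f D^{p+1} ψ_j` over the support of `B_{j,p}`. The derivative
exists off finitely many points. -/
def dualFunctional (ξ : ℕ → ℝ) (p j : ℕ) (f : ℝ → ℝ) : ℝ :=
  ∫ s in (ξ j)..(ξ (j + p + 1)), f s * iteratedDeriv (p + 1) (dualKernel ξ p j) s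

/-! ### Univariate projections -/

/-- `Π_p v = ∑_j (λ_j^p v) B_{j,p}`. -/
def proj {p : ℕ} (Ξ : OpenKnots p) (v : ℝ → ℝ) (x : ℝ) : ℝ :=
  ∑ j ∈ Finset.range Ξ.n, dualFunctional Ξ.knot p j v * bspline Ξ.knot p j x

/-- `Π^{c,1}_{p-1} v = d/dx Π_p ∫_0^x v`. -/
def projC1 {p : ℕ} (Ξ : OpenKnots p) (v : ℝ → ℝ) : ℝ → ℝ :=
  deriv (proj Ξ (fun x => ∫ t in (0 : ℝ)..x, v t))

/-- `Π^{c,2}_{p-2} v = d/dx Π^{c,1}_{p-1} ∫_0^x v`. -/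
def projC2 {p : ℕ} (Ξ : OpenKnots p) (v : ℝ → ℝ) : ℝ → ℝ :=
  deriv (projC1 Ξ (fun x => ∫ t in (0 : ℝ)..x, v t))

/-! ### Tensor products and the projections of the parametric Hessian complex -/

/-- The action of a univariate operator on the `l`-th coordinate. -/
def actOn (l : Fin 3) (T : (ℝ → ℝ) → ℝ → ℝ) (f : (Fin 3 → ℝ) → ℝ) : (Fin 3 → ℝ) → ℝ :=
  fun x => T (fun t => f (Function.update x l t)) (x l)

/-- The tensor product `T₀ ⊗ T₁ ⊗ T₂`, that is `f ↦ T₀ (T₁ (T₂ f))` with `T_l` acting on the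
`l`-th coordinate. -/
def tensor (T₀ T₁ T₂ : (ℝ → ℝ) → ℝ → ℝ) (f : (Fin 3 → ℝ) → ℝ) : (Fin 3 → ℝ) → ℝ :=
  actOn 0 T₀ (actOn 1 T₁ (actOn 2 T₂ f))

variable {p : Fin 3 → ℕ}

/-- `Π^1_h`, on scalar functions. -/
def proj1 (Ξ : ∀ l, OpenKnots (p l)) (f : (Fin 3 → ℝ) → ℝ) : (Fin 3 → ℝ) → ℝ :=
  tensor (proj (Ξ 0)) (proj (Ξ 1)) (proj (Ξ 2)) f

/-- `Π^2_h = SYM(…)`, on matrix functions; it reads the entries `11, 12, 13, 22, 23, 33`. -/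
def proj2 (Ξ : ∀ l, OpenKnots (p l)) (S : (Fin 3 → ℝ) → Matrix (Fin 3) (Fin 3) ℝ) :
    (Fin 3 → ℝ) → Matrix (Fin 3) (Fin 3) ℝ :=
  let s₁ := tensor (projC2 (Ξ 0)) (proj (Ξ 1)) (proj (Ξ 2)) (fun x => S x 0 0)
  let s₂ := tensor (projC1 (Ξ 0)) (projC1 (Ξ 1)) (proj (Ξ 2)) (fun x => S x 0 1)
  let s₃ := tensor (projC1 (Ξ 0)) (proj (Ξ 1)) (projC1 (Ξ 2)) (fun x => S x 0 2)
  let s₄ := tensor (proj (Ξ 0)) (projC2 (Ξ 1)) (proj (Ξ 2)) (fun x => S x 1 1)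
  let s₅ := tensor (proj (Ξ 0)) (projC1 (Ξ 1)) (projC1 (Ξ 2)) (fun x => S x 1 2)
  let s₆ := tensor (proj (Ξ 0)) (proj (Ξ 1)) (projC2 (Ξ 2)) (fun x => S x 2 2)
  fun x => !![s₁ x, s₂ x, s₃ x; s₂ x, s₄ x, s₅ x; s₃ x, s₅ x, s₆ x]

/-- `Π^3_h = MAT(…)`, on matrix functions. -/
def proj3 (Ξ : ∀ l, OpenKnots (p l)) (T : (Fin 3 → ℝ) → Matrix (Fin 3) (Fin 3) ℝ) :
    (Fin 3 → ℝ) → Matrix (Fin 3) (Fin 3) ℝ :=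
  let m₁ := tensor (projC1 (Ξ 0)) (projC1 (Ξ 1)) (projC1 (Ξ 2)) (fun x => T x 0 0)
  let m₂ := tensor (projC2 (Ξ 0)) (proj (Ξ 1)) (projC1 (Ξ 2)) (fun x => T x 0 1)
  let m₃ := tensor (projC2 (Ξ 0)) (projC1 (Ξ 1)) (proj (Ξ 2)) (fun x => T x 0 2)
  let m₄ := tensor (proj (Ξ 0)) (projC2 (Ξ 1)) (projC1 (Ξ 2)) (fun x => T x 1 0)
  let m₅ := tensor (projC1 (Ξ 0)) (projC1 (Ξ 1)) (projC1 (Ξ 2)) (fun x => T x 1 1)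
  let m₆ := tensor (projC1 (Ξ 0)) (projC2 (Ξ 1)) (proj (Ξ 2)) (fun x => T x 1 2)
  let m₇ := tensor (proj (Ξ 0)) (projC1 (Ξ 1)) (projC2 (Ξ 2)) (fun x => T x 2 0)
  let m₈ := tensor (projC1 (Ξ 0)) (proj (Ξ 1)) (projC2 (Ξ 2)) (fun x => T x 2 1)
  let m₉ := tensor (projC1 (Ξ 0)) (projC1 (Ξ 1)) (projC1 (Ξ 2)) (fun x => T x 2 2)
  fun x => !![m₁ x, m₂ x, m₃ x; m₄ x, m₅ x, m₆ x; m₇ x, m₈ x, m₉ x]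

/-- `Π^4_h`, on vector functions. -/
def proj4 (Ξ : ∀ l, OpenKnots (p l)) (v : (Fin 3 → ℝ) → Fin 3 → ℝ) :
    (Fin 3 → ℝ) → Fin 3 → ℝ :=
  let v₁ := tensor (projC2 (Ξ 0)) (projC1 (Ξ 1)) (projC1 (Ξ 2)) (fun x => v x 0)
  let v₂ := tensor (projC1 (Ξ 0)) (projC2 (Ξ 1)) (projC1 (Ξ 2)) (fun x => v x 1)
  let v₃ := tensor (projC1 (Ξ 0)) (projC1 (Ξ 1)) (projC2 (Ξ 2)) (fun x => v x 2)
  fun x => ![v₁ x, v₂ x, v₃ x]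

/-! ### Mesh elements and `L²` norms -/

/-- The parametric domain `(0,1)³`. -/
def cube : Set (Fin 3 → ℝ) :=
  univ.pi (fun _ => Ioo (0 : ℝ) 1)

/-- The mesh element `K = ∏_l (ξ^l_{j_l}, ξ^l_{j_l+1})`. -/
def element (Ξ : ∀ l, OpenKnots (p l)) (j : Fin 3 → ℕ) : Set (Fin 3 → ℝ) :=
  univ.pi (fun l => Ioo ((Ξ l).knot (j l)) ((Ξ l).knot (j l + 1)))

/-- The support extension `∏_l (ξ^l_{j_l-p_l}, ξ^l_{j_l+p_l+1})`. For a mesh element, `p_l ≤ j_l`. -/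
def extension (Ξ : ∀ l, OpenKnots (p l)) (j : Fin 3 → ℕ) : Set (Fin 3 → ℝ) :=
  univ.pi (fun l => Ioo ((Ξ l).knot (j l - p l)) ((Ξ l).knot (j l + p l + 1)))

/-- `w ∈ L²(D)`, for a scalar function. -/
def MemL2 (D : Set (Fin 3 → ℝ)) (w : (Fin 3 → ℝ) → ℝ) : Prop :=
  MemLp w 2 (volume.restrict D)

/-- `‖w‖_{L²(D)}`. -/
def normL2 (D : Set (Fin 3 → ℝ)) (w : (Fin 3 → ℝ) → ℝ) : ℝ≥0∞ :=
  eLpNorm w 2 (volume.restrict D)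

/-- `‖v‖_{L²(D)} = (∑_i ‖v_i‖²)^{1/2}`. -/
def vecNormL2 (D : Set (Fin 3 → ℝ)) (v : (Fin 3 → ℝ) → Fin 3 → ℝ) : ℝ≥0∞ :=
  (∑ i, normL2 D (fun x => v x i) ^ 2) ^ (1 / 2 : ℝ)

/-- `‖M‖_{L²(D)} = (∑_{i,j} ‖M_{ij}‖²)^{1/2}`. -/
def matNormL2 (D : Set (Fin 3 → ℝ)) (M : (Fin 3 → ℝ) → Matrix (Fin 3) (Fin 3) ℝ) : ℝ≥0∞ :=
  (∑ i, ∑ j, normL2 D (fun x => M x i j) ^ 2) ^ (1 / 2 : ℝ)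

end

end SplineHessian

open SplineHessian

/-!
Each dual functional `λ_j^p` is integration against a density of size `O(1/h)` on the support of
`B_{j,p}`: by Leibniz' rule every term of `D^{p+1} ψ_j` scales like the inverse length of that
support, the transition function being the primitive of a B-spline with simple knots and hence
piecewise smooth with `p` continuous derivatives. On a mesh element of length `h` only `p + 1`
B-splines are nonzero, and their derivatives of order `k` are `O(h^{-k})`.

The projection `Π^{c,k}_{p-k}` is `D^k Π_p` applied to a `k`-fold primitive from `0`, which sees `v`
far away from the element. Since `Π_p` reproduces affine functions (partition of unity for the
constants, Greville abscissae for the identity), the primitives may start at the left end of the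
support extension instead. Integration by parts moves them onto the density, which gains a factor
`O(h^k)` and compensates the derivatives of the B-splines. So on an element each univariate
projection is an integral operator from the support extension, with a kernel of bounded
Hilbert–Schmidt norm. Such operators may be applied one coordinate after the other, by the
Cauchy–Schwarz inequality and Tonelli's theorem.
-/

namespace SplineHessian

/-! ### B-splines -/

section Bspline

variable {ξ : ℕ → ℝ}

/-- The B-spline `B_{j,p}` divided by the length of its support, i.e. `1 / (p + 1)` times the
B-spline of integral one. If the support degenerates to a point this is `0 / 0 = 0`, in agreement
with the Cox–de Boor recursion. -/
noncomputable def normBspline (ξ : ℕ → ℝ) (p j : ℕ) (x : ℝ) : ℝ :=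
  bspline ξ p j x / (ξ (j + p + 1) - ξ j)

lemma bspline_succ (ξ : ℕ → ℝ) (p j : ℕ) (x : ℝ) :
    bspline ξ (p + 1) j x =
      (x - ξ j) * normBspline ξ p j x + (ξ (j + p + 2) - x) * normBspline ξ p (j + 1) x := by
  rw [bspline, normBspline, normBspline, show j + 1 + p + 1 = j + p + 2 by omega]
  ring

lemma bspline_congr {η : ℕ → ℝ} (p : ℕ) :
    ∀ j, (∀ i, j ≤ i → i ≤ j + p + 1 → ξ i = η i) → bspline ξ p j = bspline η p j := by
  induction p with
  | zero =>
    intro j h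
    funext x
    rw [bspline, bspline, h j le_rfl (by omega), h (j + 1) (by omega) (by omega)]
  | succ p ih =>
    intro j h
    funext x
    rw [bspline, bspline, ih j (fun i h₁ h₂ => h i h₁ (by omega)),
      ih (j + 1) (fun i h₁ h₂ => h i (by omega) (by omega)), h j le_rfl (by omega),
      h (j + p + 1) (by omega) (by omega), h (j + p + 2) (by omega) (by omega),
      h (j + 1) (by omega) (by omega)]

lemma measurable_bspline (ξ : ℕ → ℝ) (p : ℕ) : ∀ j, Measurable (bspline ξ p j) := by
  induction p with
  | zero => exact fun j => measurable_const.indicator measurableSet_Ico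
  | succ p ih =>
    intro j
    have := ih j
    have := ih (j + 1)
    rw [funext (bspline_succ ξ p j)]
    unfold normBspline
    fun_prop

lemma measurable_iteratedDeriv_bspline (ξ : ℕ → ℝ) (k p j : ℕ) :
    Measurable (iteratedDeriv k (bspline ξ p j)) := by
  cases k with
  | zero => rw [iteratedDeriv_zero]; exact measurable_bspline ξ p j
  | succ k => rw [iteratedDeriv_succ]; exact measurable_deriv _

lemma bspline_zero_eventuallyEq {x : ℝ} (hx : x ∉ range ξ) (j : ℕ) :
    bspline ξ 0 j =ᶠ[nhds x] fun _ => bspline ξ 0 j x := by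
  have hj : x ≠ ξ j := fun h => hx ⟨j, h.symm⟩
  have hj' : x ≠ ξ (j + 1) := fun h => hx ⟨j + 1, h.symm⟩
  by_cases hI : x ∈ Ico (ξ j) (ξ (j + 1))
  · filter_upwards [Ioo_mem_nhds (lt_of_le_of_ne hI.1 hj.symm) hI.2] with y hy
    rw [bspline, bspline, indicator_of_mem hI, indicator_of_mem (Ioo_subset_Ico_self hy)]
  · have hc : x ∉ Icc (ξ j) (ξ (j + 1)) := fun h => hI ⟨h.1, lt_of_le_of_ne h.2 hj'⟩
    filter_upwards [isClosed_Icc.isOpen_compl.mem_nhds hc] with y hy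
    rw [bspline, bspline, indicator_of_notMem hI,
      indicator_of_notMem (fun h => hy (Ico_subset_Icc_self h))]

lemma contDiffAt_bspline {n : WithTop ℕ∞} {x : ℝ} (hx : x ∉ range ξ) (p : ℕ) :
    ∀ j, ContDiffAt ℝ n (bspline ξ p j) x := by
  induction p with
  | zero => exact fun j => contDiffAt_const.congr_of_eventuallyEq (bspline_zero_eventuallyEq hx j)
  | succ p ih =>
    intro j
    have := ih j
    have := ih (j + 1)
    rw [funext (bspline_succ ξ p j)]
    unfold normBspline
    fun_prop

lemma bspline_of_notMem (hξ : Monotone ξ) {x : ℝ} (p : ℕ) :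
    ∀ j, x ∉ Ico (ξ j) (ξ (j + p + 1)) → bspline ξ p j x = 0 := by
  induction p with
  | zero => exact fun j h => indicator_of_notMem h _
  | succ p ih =>
    intro j h
    have hl : x ∉ Ico (ξ j) (ξ (j + p + 1)) :=
      fun hx => h (Ico_subset_Ico_right (hξ (by omega)) hx)
    have hr : x ∉ Ico (ξ (j + 1)) (ξ (j + 1 + p + 1)) :=
      fun hx => h (Ico_subset_Ico (hξ (by omega)) (hξ (by omega)) hx)
    rw [bspline, ih j hl, ih (j + 1) hr, mul_zero, mul_zero, add_zero]

lemma bspline_of_lt (hξ : Monotone ξ) {x : ℝ} {p j : ℕ} (h : x < ξ j) : bspline ξ p j x = 0 :=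
  bspline_of_notMem hξ p j fun hx => hx.1.not_gt h

lemma bspline_of_ge (hξ : Monotone ξ) {x : ℝ} {p j : ℕ} (h : ξ (j + p + 1) ≤ x) :
    bspline ξ p j x = 0 :=
  bspline_of_notMem hξ p j fun hx => hx.2.not_ge h

lemma sub_mul_normBspline (hξ : Monotone ξ) (p j : ℕ) (x : ℝ) :
    (ξ (j + p + 1) - ξ j) * normBspline ξ p j x = bspline ξ p j x := by
  by_cases h : ξ (j + p + 1) - ξ j = 0
  · have hx : x ∉ Ico (ξ j) (ξ (j + p + 1)) := by
      rw [sub_eq_zero.1 h, Ico_self]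
      exact notMem_empty x
    rw [h, zero_mul, bspline_of_notMem hξ p j hx]
  · exact mul_div_cancel₀ _ h

lemma abs_bspline_le (hξ : Monotone ξ) (x : ℝ) (p : ℕ) : ∀ j, |bspline ξ p j x| ≤ 2 ^ p := by
  have weighted_le : ∀ p j (w : ℝ), (x ∈ Ico (ξ j) (ξ (j + p + 1)) → |w| ≤ 1) →
      |w * bspline ξ p j x| ≤ |bspline ξ p j x| := fun p j w hw => by
    by_cases hx : x ∈ Ico (ξ j) (ξ (j + p + 1))
    · rw [abs_mul]
      exact mul_le_of_le_one_left (abs_nonneg _) (hw hx)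
    · rw [bspline_of_notMem hξ p j hx, mul_zero]
  induction p with
  | zero =>
    intro j
    have : bspline ξ 0 j x = 0 ∨ bspline ξ 0 j x = 1 := indicator_eq_zero_or_self ..
    rcases this with h | h <;> simp [h]
  | succ p ih =>
    intro j
    have h₀ := weighted_le p j ((x - ξ j) / (ξ (j + p + 1) - ξ j)) fun hx => by
      rw [abs_of_nonneg (div_nonneg (by linarith [hx.1]) (by linarith [hx.1, hx.2]))]
      exact div_le_one_of_le₀ (by linarith [hx.2]) (by linarith [hx.1, hx.2])
    have h₁ := weighted_le p (j + 1) ((ξ (j + p + 2) - x) / (ξ (j + p + 2) - ξ (j + 1)))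
      fun hx => by
        rw [show j + 1 + p + 1 = j + p + 2 by omega] at hx
        rw [abs_of_nonneg (div_nonneg (by linarith [hx.2]) (by linarith [hx.1, hx.2]))]
        exact div_le_one_of_le₀ (by linarith [hx.1]) (by linarith [hx.1, hx.2])
    calc |bspline ξ (p + 1) j x| ≤ |bspline ξ p j x| + |bspline ξ p (j + 1) x| :=
          (abs_add_le _ _).trans (add_le_add h₀ h₁)
      _ ≤ 2 ^ p + 2 ^ p := add_le_add (ih j) (ih (j + 1))
      _ = 2 ^ (p + 1) := by ring

lemma intervalIntegrable_bspline (hξ : Monotone ξ) (p j : ℕ) (a b : ℝ) :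
    IntervalIntegrable (bspline ξ p j) volume a b :=
  (intervalIntegrable_const (c := (2 : ℝ) ^ p)).mono_fun
    (measurable_bspline ξ p j).aestronglyMeasurable
    (.of_forall fun x => (abs_bspline_le hξ x p j).trans (le_abs_self _))

lemma hasDerivAt_bspline_succ_of_hasDerivAt {x : ℝ} {q j : ℕ} {b₀ b₁ : ℝ}
    (h₀ : HasDerivAt (bspline ξ q j) b₀ x) (h₁ : HasDerivAt (bspline ξ q (j + 1)) b₁ x) :
    HasDerivAt (bspline ξ (q + 1) j)
      (normBspline ξ q j x + (x - ξ j) * (b₀ / (ξ (j + q + 1) - ξ j)) +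
        (-normBspline ξ q (j + 1) x +
          (ξ (j + q + 2) - x) * (b₁ / (ξ (j + 1 + q + 1) - ξ (j + 1))))) x := by
  rw [funext (bspline_succ ξ q j)]
  refine ((((hasDerivAt_id x).sub_const (ξ j)).mul (h₀.div_const _)).add
    (((hasDerivAt_id x).const_sub (ξ (j + q + 2))).mul (h₁.div_const _))).congr_deriv ?_
  simp only [normBspline, id_eq, one_mul, neg_mul]

lemma sub_mul_normBspline_div_sub (hξ : Monotone ξ) {p i j k : ℕ} (hi : i ≤ j)
    (hk : j + p + 1 ≤ k) (x : ℝ) :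
    (ξ k - ξ i) * normBspline ξ p j x / (ξ k - ξ i) = normBspline ξ p j x := by
  by_cases h : ξ k - ξ i = 0
  · have hj : ξ j ≤ ξ (j + p + 1) := hξ (by omega)
    have support_eq_zero : ξ (j + p + 1) - ξ j = 0 := by linarith [hξ hi, hξ hk]
    rw [normBspline, support_eq_zero, div_zero, mul_zero, zero_div]
  · exact mul_div_cancel_left₀ _ h

lemma hasDerivAt_bspline (hξ : Monotone ξ) {x : ℝ} (hx : x ∉ range ξ) (p : ℕ) :
    ∀ j, HasDerivAt (bspline ξ (p + 1) j)
      ((p + 1) * (normBspline ξ p j x - normBspline ξ p (j + 1) x)) x := by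
  induction p with
  | zero =>
    intro j
    have hzero : ∀ i, HasDerivAt (bspline ξ 0 i) 0 x := fun i =>
      (hasDerivAt_const x _).congr_of_eventuallyEq (bspline_zero_eventuallyEq hx i)
    refine (hasDerivAt_bspline_succ_of_hasDerivAt (hzero j) (hzero (j + 1))).congr_deriv ?_
    push_cast
    ring
  | succ p ih =>
    intro j
    refine (hasDerivAt_bspline_succ_of_hasDerivAt (ih j) (ih (j + 1))).congr_deriv ?_
    have cancel₀ := sub_mul_normBspline_div_sub hξ (p := p) (i := j) (j := j + 1)
      (k := j + p + 2) (by omega) (by omega) x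
    have cancel₁ := sub_mul_normBspline_div_sub hξ (p := p) (i := j + 1) (j := j + 1)
      (k := j + p + 3) le_rfl (by omega) x
    have h₀ : normBspline ξ (p + 1) j x =
        ((x - ξ j) * normBspline ξ p j x + (ξ (j + p + 2) - x) * normBspline ξ p (j + 1) x) /
          (ξ (j + p + 2) - ξ j) := by
      rw [normBspline, bspline_succ]
      rfl
    have h₁ : normBspline ξ (p + 1) (j + 1) x =
        ((x - ξ (j + 1)) * normBspline ξ p (j + 1) x +
          (ξ (j + p + 3) - x) * normBspline ξ p (j + 2) x) / (ξ (j + p + 3) - ξ (j + 1)) := by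
      rw [normBspline, bspline_succ, show j + 1 + p + 2 = j + p + 3 by omega,
        show j + 1 + (p + 1) + 1 = j + p + 3 by omega]
    rw [show j + (p + 1) + 2 = j + p + 3 by omega, show j + 1 + (p + 1) + 1 = j + p + 3 by omega,
      show j + (p + 1) + 1 = j + p + 2 by omega]
    push_cast
    linear_combination (p + 1 : ℝ) * (-h₀ + h₁ - cancel₀ + cancel₁)

lemma abs_iteratedDeriv_normBspline_le (hξ : Monotone ξ) {m p : ℕ} {x C : ℝ} {k : ℕ}
    (hx : x ∈ Ioo (ξ m) (ξ (m + 1))) (j : ℕ) (hC : |iteratedDeriv k (bspline ξ p j) x| ≤ C) :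
    |iteratedDeriv k (normBspline ξ p j) x| ≤ C / (ξ (m + 1) - ξ m) := by
  have hm : 0 < ξ (m + 1) - ξ m := sub_pos.2 (hx.1.trans hx.2)
  have hC0 : 0 ≤ C := (abs_nonneg _).trans hC
  have hdiv : iteratedDeriv k (normBspline ξ p j) x =
      iteratedDeriv k (bspline ξ p j) x / (ξ (j + p + 1) - ξ j) := iteratedDeriv_div_const _ _
  by_cases hj : j ≤ m ∧ m + 1 ≤ j + p + 1
  · have hd : ξ (m + 1) - ξ m ≤ ξ (j + p + 1) - ξ j := sub_le_sub (hξ hj.2) (hξ hj.1)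
    rw [hdiv, abs_div, abs_of_pos (hm.trans_le hd)]
    exact div_le_div₀ hC0 hC hm hd
  · have hzero : EqOn (bspline ξ p j) (fun _ => 0) (Ioo (ξ m) (ξ (m + 1))) := fun y hy => by
      rcases not_and_or.1 hj with h | h
      · exact bspline_of_lt hξ (hy.2.trans_le (hξ (by omega)))
      · exact bspline_of_ge hξ ((hξ (by omega)).trans hy.1.le)
    rw [hdiv, hzero.iteratedDeriv_of_isOpen isOpen_Ioo k hx, iteratedDeriv_fun_const_zero,
      zero_div, abs_zero]
    exact div_nonneg hC0 hm.le

lemma notMem_range_of_mem_Ioo (hξ : Monotone ξ) {m : ℕ} {x : ℝ}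
    (hx : x ∈ Ioo (ξ m) (ξ (m + 1))) : x ∉ range ξ := by
  rintro ⟨i, rfl⟩
  exact (hξ.reflect_lt hx.1).not_ge (Nat.lt_succ_iff.1 (hξ.reflect_lt hx.2))

lemma abs_iteratedDeriv_bspline_le (hξ : Monotone ξ) {m : ℕ} {x : ℝ}
    (hx : x ∈ Ioo (ξ m) (ξ (m + 1))) (k : ℕ) :
    ∀ p j, |iteratedDeriv k (bspline ξ p j) x| ≤ 2 ^ p * (2 * p / (ξ (m + 1) - ξ m)) ^ k := by
  induction k with
  | zero => simpa using fun p j => abs_bspline_le hξ x p j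
  | succ k ih =>
    rintro (_ | p) j
    · have hderiv : EqOn (deriv (bspline ξ 0 j)) (fun _ => 0) (Ioo (ξ m) (ξ (m + 1))) := fun y hy =>
        (bspline_zero_eventuallyEq (notMem_range_of_mem_Ioo hξ hy) j).deriv_eq.trans
          (deriv_const y _)
      rw [iteratedDeriv_succ', hderiv.iteratedDeriv_of_isOpen isOpen_Ioo k hx,
        iteratedDeriv_fun_const_zero]
      simp
    · have hx' := notMem_range_of_mem_Ioo hξ hx
      have hm : 0 < ξ (m + 1) - ξ m := sub_pos.2 (hx.1.trans hx.2)
      have hderiv : EqOn (deriv (bspline ξ (p + 1) j))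
          (fun y => (p + 1) * (normBspline ξ p j - normBspline ξ p (j + 1)) y)
          (Ioo (ξ m) (ξ (m + 1))) := fun y hy =>
        (hasDerivAt_bspline hξ (notMem_range_of_mem_Ioo hξ hy) p j).deriv
      have hN : ∀ i, ContDiffAt ℝ k (normBspline ξ p i) x := fun i =>
        (contDiffAt_bspline hx' p i).div_const _
      have hle : ∀ i, |iteratedDeriv k (normBspline ξ p i) x| ≤
          2 ^ p * (2 * p / (ξ (m + 1) - ξ m)) ^ k / (ξ (m + 1) - ξ m) := fun i =>
        abs_iteratedDeriv_normBspline_le hξ hx i (ih p i)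
      rw [iteratedDeriv_succ', hderiv.iteratedDeriv_of_isOpen isOpen_Ioo k hx,
        iteratedDeriv_const_mul_field, iteratedDeriv_sub (hN j) (hN (j + 1)), abs_mul,
        abs_of_nonneg (by positivity : (0 : ℝ) ≤ p + 1)]
      calc (p + 1 : ℝ) * |iteratedDeriv k (normBspline ξ p j) x -
              iteratedDeriv k (normBspline ξ p (j + 1)) x|
          ≤ (p + 1) * (2 ^ p * (2 * p / (ξ (m + 1) - ξ m)) ^ k / (ξ (m + 1) - ξ m) +
              2 ^ p * (2 * p / (ξ (m + 1) - ξ m)) ^ k / (ξ (m + 1) - ξ m)) := by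
            gcongr
            exact (abs_sub _ _).trans (add_le_add (hle j) (hle (j + 1)))
        _ = 2 ^ p * (2 * (p + 1) / (ξ (m + 1) - ξ m)) * (2 * p / (ξ (m + 1) - ξ m)) ^ k := by ring
        _ ≤ 2 ^ (p + 1) * (2 * (p + 1) / (ξ (m + 1) - ξ m)) *
              (2 * (p + 1) / (ξ (m + 1) - ξ m)) ^ k := by
            gcongr <;> linarith [one_le_two (α := ℝ)]
        _ = 2 ^ (p + 1) * (2 * (p + 1 : ℕ) / (ξ (m + 1) - ξ m)) ^ (k + 1) := by
            push_cast
            ring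

section Reproduction

variable {x : ℝ} {m q N : ℕ}

/-- The new coefficients are those of a step of de Boor's algorithm. The truncated subtraction at
`j = 0` is harmless, since `normBspline ξ q 0` vanishes at `x`. -/
lemma sum_mul_bspline_succ (hξ : Monotone ξ) (hx : x ∈ Ico (ξ m) (ξ (m + 1))) (hq : q < m)
    (hN : m < N) (c : ℕ → ℝ) :
    ∑ j ∈ Finset.range N, c j * bspline ξ (q + 1) j x =
      ∑ j ∈ Finset.range N,
        (c j * (x - ξ j) + c (j - 1) * (ξ (j + q + 1) - x)) * normBspline ξ q j x := by
  set F : ℕ → ℝ := fun j => c (j - 1) * (ξ (j + q + 1) - x) * normBspline ξ q j x with hF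
  have first_eq_zero : F 0 = 0 := by
    simp only [hF, normBspline]
    rw [bspline_of_ge hξ ((hξ (by omega)).trans hx.1), zero_div, mul_zero]
  have last_eq_zero : F N = 0 := by
    simp only [hF, normBspline]
    rw [bspline_of_lt hξ (hx.2.trans_le (hξ (by omega))), zero_div, mul_zero]
  have shift : ∑ j ∈ Finset.range N, F (j + 1) = ∑ j ∈ Finset.range N, F j := by
    linarith [Finset.sum_range_succ' F N, Finset.sum_range_succ F N]
  calc ∑ j ∈ Finset.range N, c j * bspline ξ (q + 1) j x
      = ∑ j ∈ Finset.range N, (c j * (x - ξ j) * normBspline ξ q j x + F (j + 1)) := by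
        refine Finset.sum_congr rfl fun j _ => ?_
        simp only [hF, bspline_succ, Nat.add_sub_cancel, show j + 1 + q + 1 = j + q + 2 by omega]
        ring
    _ = _ := by
        rw [Finset.sum_add_distrib, shift, ← Finset.sum_add_distrib]
        exact Finset.sum_congr rfl fun j _ => (add_mul _ _ _).symm

lemma sum_bspline_eq_one (hξ : Monotone ξ) (hx : x ∈ Ico (ξ m) (ξ (m + 1))) (hN : m < N)
    (hq : q ≤ m) : ∑ j ∈ Finset.range N, bspline ξ q j x = 1 := by
  induction q with
  | zero =>
    rw [Finset.sum_eq_single_of_mem m (Finset.mem_range.2 hN) fun j _ hj => ?_]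
    · exact indicator_of_mem hx _
    · rcases lt_or_gt_of_ne hj with h | h
      · exact bspline_of_ge hξ ((hξ (by omega)).trans hx.1)
      · exact bspline_of_lt hξ (hx.2.trans_le (hξ (by omega)))
  | succ q ih =>
    have hstep := sum_mul_bspline_succ hξ hx hq hN fun _ => 1
    simp only [one_mul, sub_add_sub_cancel'] at hstep
    rw [hstep, ← ih (by omega)]
    exact Finset.sum_congr rfl fun j _ => sub_mul_normBspline hξ q j x

/-- Marsden's identity for linear functions; the coefficients are `q` times the Greville points. -/
lemma sum_sum_knot_mul_bspline (hξ : Monotone ξ) (hx : x ∈ Ico (ξ m) (ξ (m + 1))) (hN : m < N)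
    (hq : q ≤ m) :
    ∑ j ∈ Finset.range N, (∑ k ∈ Finset.range q, ξ (j + k + 1)) * bspline ξ q j x = q * x := by
  induction q with
  | zero => simp
  | succ q ih =>
    rw [sum_mul_bspline_succ hξ hx hq hN fun j => ∑ k ∈ Finset.range (q + 1), ξ (j + k + 1)]
    have hterm : ∀ j, ((∑ k ∈ Finset.range (q + 1), ξ (j + k + 1)) * (x - ξ j) +
          (∑ k ∈ Finset.range (q + 1), ξ (j - 1 + k + 1)) * (ξ (j + q + 1) - x)) *
            normBspline ξ q j x =
        (∑ k ∈ Finset.range q, ξ (j + k + 1)) * bspline ξ q j x + x * bspline ξ q j x := by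
      rintro (_ | j)
      · rw [normBspline, bspline_of_ge hξ ((hξ (by omega)).trans hx.1)]
        simp
      · have hprev : ∑ k ∈ Finset.range (q + 1), ξ (j + 1 - 1 + k + 1) =
            ∑ k ∈ Finset.range q, ξ (j + 1 + k + 1) + ξ (j + 1) := by
          rw [Finset.sum_range_succ', Nat.add_sub_cancel]
          simp only [add_right_comm, add_zero, ← add_assoc]
        rw [hprev, Finset.sum_range_succ, ← sub_mul_normBspline hξ]
        ring
    rw [Finset.sum_congr rfl fun j _ => hterm j, Finset.sum_add_distrib, ← Finset.mul_sum,
      ih (by omega), sum_bspline_eq_one hξ hx hN (by omega)]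
    push_cast
    ring

end Reproduction

lemma hasDerivAt_of_off_countable {S : Set ℝ} (hS : S.Countable) {f f' : ℝ → ℝ}
    (hf : Continuous f) (hf' : Continuous f') (h : ∀ x, x ∉ S → HasDerivAt f (f' x) x) (x : ℝ) :
    HasDerivAt f (f' x) x := by
  have hF : f = fun y => f 0 + ∫ t in (0 : ℝ)..y, f' t := by
    funext y
    rw [integral_eq_of_hasDerivAt_off_countable f f' hS hf.continuousOn
      (fun z hz => h z hz.2) (hf'.intervalIntegrable _ _), add_sub_cancel]
  rw [hF]
  exact (hf'.integral_hasStrictDerivAt 0 x).hasDerivAt.const_add _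

lemma bspline_one_eq_max_min (hξ : StrictMono ξ) (j : ℕ) :
    bspline ξ 1 j = fun x => max 0 (min ((x - ξ j) / (ξ (j + 1) - ξ j))
      ((ξ (j + 2) - x) / (ξ (j + 2) - ξ (j + 1)))) := by
  funext x
  have h₀ : 0 < ξ (j + 1) - ξ j := sub_pos.2 (hξ (by omega))
  have h₁ : 0 < ξ (j + 2) - ξ (j + 1) := sub_pos.2 (hξ (by omega))
  have hrec : bspline ξ 1 j x = (x - ξ j) / (ξ (j + 1) - ξ j) *
      (Ico (ξ j) (ξ (j + 1))).indicator (fun _ => 1) x +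
      (ξ (j + 2) - x) / (ξ (j + 2) - ξ (j + 1)) *
        (Ico (ξ (j + 1)) (ξ (j + 2))).indicator (fun _ => 1) x := rfl
  rw [hrec]
  simp only [indicator_apply, mem_Ico, mul_ite, mul_one, mul_zero]
  have hnonneg : 0 ≤ (x - ξ j) / (ξ (j + 1) - ξ j) ↔ ξ j ≤ x := by
    rw [le_div_iff₀ h₀, zero_mul, sub_nonneg]
  have hnonneg' : 0 ≤ (ξ (j + 2) - x) / (ξ (j + 2) - ξ (j + 1)) ↔ x ≤ ξ (j + 2) := by
    rw [le_div_iff₀ h₁, zero_mul, sub_nonneg]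
  have hle : (x - ξ j) / (ξ (j + 1) - ξ j) ≤ 1 ↔ x ≤ ξ (j + 1) := by
    rw [div_le_one h₀]; exact sub_le_sub_iff_right _
  have hle' : (ξ (j + 2) - x) / (ξ (j + 2) - ξ (j + 1)) ≤ 1 ↔ ξ (j + 1) ≤ x := by
    rw [div_le_one h₁]; exact sub_le_sub_iff_left _
  grind

lemma continuous_bspline_succ (hξ : StrictMono ξ) (p : ℕ) :
    ∀ j, Continuous (bspline ξ (p + 1) j) := by
  induction p with
  | zero =>
    intro j
    rw [bspline_one_eq_max_min hξ]
    fun_prop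
  | succ p ih =>
    intro j
    have := ih j
    have := ih (j + 1)
    rw [funext (bspline_succ ξ (p + 1) j)]
    unfold normBspline
    fun_prop

lemma contDiff_bspline_succ (hξ : StrictMono ξ) (p : ℕ) :
    ∀ j, ContDiff ℝ p (bspline ξ (p + 1) j) := by
  induction p with
  | zero => exact fun j => contDiff_zero.2 (continuous_bspline_succ hξ 0 j)
  | succ p ih =>
    intro j
    have hN : ∀ i, ContDiff ℝ p (normBspline ξ (p + 1) i) := fun i => (ih i).div_const _
    have hderiv : ∀ x, HasDerivAt (bspline ξ (p + 1 + 1) j)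
        (((p + 1 : ℕ) + 1) * (normBspline ξ (p + 1) j x - normBspline ξ (p + 1) (j + 1) x)) x :=
      hasDerivAt_of_off_countable (countable_range ξ) (continuous_bspline_succ hξ (p + 1) j)
        (((hN j).sub (hN (j + 1))).continuous.const_mul _)
        fun x hx => hasDerivAt_bspline hξ.monotone hx (p + 1) j
    push_cast
    rw [contDiff_succ_iff_deriv]
    refine ⟨fun x => (hderiv x).differentiableAt, by simp, ?_⟩
    rw [funext fun x => (hderiv x).deriv]
    exact contDiff_const.mul ((hN j).sub (hN (j + 1)))

lemma intervalIntegrable_normBspline (hξ : Monotone ξ) (p j : ℕ) (a b : ℝ) :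
    IntervalIntegrable (normBspline ξ p j) volume a b :=
  (intervalIntegrable_bspline hξ p j a b).div_const _

lemma integral_normBspline_zero {a b : ℝ} {j : ℕ} (hj : ξ j < ξ (j + 1)) (ha : a ≤ ξ j)
    (hb : ξ (j + 1) ≤ b) : ∫ x in a..b, normBspline ξ 0 j x = 1 := by
  simp only [normBspline, bspline, add_zero]
  rw [intervalIntegral.integral_div, intervalIntegral.integral_of_le (ha.trans (hj.le.trans hb)),
    ← integral_Icc_eq_integral_Ioc, integral_indicator measurableSet_Ico,
    Measure.restrict_restrict measurableSet_Ico,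
    inter_eq_left.2 (Ico_subset_Icc_self.trans (Icc_subset_Icc ha hb))]
  simp [hj.le, (sub_pos.2 hj).ne']

lemma hasDerivAt_sub_mul_bspline_succ (hξ : Monotone ξ) {x : ℝ} (hx : x ∉ range ξ) (p j : ℕ) :
    HasDerivAt (fun x => (x - ξ j) * bspline ξ (p + 1) j x) ((ξ (j + p + 2) - ξ j) *
      ((p + 2) * normBspline ξ (p + 1) j x - (p + 1) * normBspline ξ p (j + 1) x)) x := by
  refine (((hasDerivAt_id x).sub_const (ξ j)).mul (hasDerivAt_bspline hξ hx p j)).congr_deriv ?_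
  have h := sub_mul_normBspline hξ (p + 1) j x
  rw [show j + (p + 1) + 1 = j + p + 2 by omega] at h
  rw [id]
  linear_combination (-(p + 2) : ℝ) * h - (p + 1 : ℝ) * bspline_succ ξ p j x

lemma integral_normBspline (hξ : StrictMono ξ) (p : ℕ) {a b : ℝ} :
    ∀ j, a ≤ ξ j → ξ (j + p + 1) ≤ b → ∫ x in a..b, normBspline ξ p j x = 1 / (p + 1) := by
  induction p with
  | zero =>
    intro j ha hb
    rw [integral_normBspline_zero (hξ j.lt_succ_self) ha hb, Nat.cast_zero, zero_add, div_one]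
  | succ p ih =>
    intro j ha hb
    have integrable : ∀ (c : ℝ) q i, IntervalIntegrable (fun x => c * normBspline ξ q i x)
      volume a b := fun c q i => (intervalIntegrable_normBspline hξ.monotone q i a b).const_mul c
    have hd : 0 < ξ (j + p + 2) - ξ j := sub_pos.2 (hξ (by omega))
    have hab : a ≤ b := ha.trans ((hξ.monotone (by omega)).trans hb)
    have ftc := integral_eq_of_hasDerivAt_off_countable_of_le _ _ hab (countable_range ξ)
      (by have := continuous_bspline_succ hξ p j; fun_prop)
      (fun x hx => hasDerivAt_sub_mul_bspline_succ hξ.monotone hx.2 p j)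
      (((integrable _ _ _).sub (integrable _ _ _)).const_mul _)
    have left_eq_zero : (a - ξ j) * bspline ξ (p + 1) j a = 0 := by
      rcases ha.lt_or_eq with h | h
      · rw [bspline_of_lt hξ.monotone h, mul_zero]
      · rw [h, sub_self, zero_mul]
    rw [intervalIntegral.integral_const_mul,
      intervalIntegral.integral_sub (integrable _ _ _) (integrable _ _ _),
      intervalIntegral.integral_const_mul, intervalIntegral.integral_const_mul,
      ih (j + 1) (ha.trans (hξ.monotone (by omega))) (le_of_eq_of_le (by congr 1; omega) hb),
      left_eq_zero, bspline_of_ge hξ.monotone hb, mul_zero, sub_zero, mul_eq_zero,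
      or_iff_right hd.ne'] at ftc
    rw [eq_div_iff (by positivity)]
    have : (p + 1 : ℝ) * (1 / (p + 1)) = 1 := mul_one_div_cancel (by positivity)
    push_cast
    linarith

end Bspline

/-! ### The transition function -/

lemma exists_abs_iteratedDeriv_bspline_le {ξ : ℕ → ℝ} (hξ : Monotone ξ) (p j n K : ℕ) :
    ∃ M : ℝ, ∀ k ≤ K, ∀ x ∈ Icc (ξ 0) (ξ n), x ∉ range ξ →
      |iteratedDeriv k (bspline ξ p j) x| ≤ M := by
  set bound : ℕ → ℕ → ℝ := fun m k => 2 ^ p * (2 * p / (ξ (m + 1) - ξ m)) ^ k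
  have bound_nonneg : ∀ m k, 0 ≤ bound m k := fun m k => by
    have : 0 ≤ ξ (m + 1) - ξ m := sub_nonneg.2 (hξ m.le_succ)
    positivity
  refine ⟨∑ m ∈ Finset.range n, ∑ k ∈ Finset.range (K + 1), bound m k, fun k hk x hx hx' => ?_⟩
  have ne_knot : ∀ i, x ≠ ξ i := fun i h => hx' ⟨i, h.symm⟩
  have hx_union : x ∈ ⋃ m ∈ Ico 0 n, Ioc (ξ m) (ξ (m + 1)) := by
    have := hξ.biUnion_Ico_Ioc_map_succ 0 n
    rw [Nat.succ_eq_succ] at this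
    exact this ▸ ⟨lt_of_le_of_ne hx.1 (ne_knot 0).symm, hx.2⟩
  simp only [mem_iUnion] at hx_union
  obtain ⟨m, hm, hxm⟩ := hx_union
  calc |iteratedDeriv k (bspline ξ p j) x| ≤ bound m k :=
        abs_iteratedDeriv_bspline_le hξ ⟨hxm.1, lt_of_le_of_ne hxm.2 (ne_knot _)⟩ k p j
    _ ≤ ∑ k ∈ Finset.range (K + 1), bound m k :=
        Finset.single_le_sum (fun i _ => bound_nonneg m i) (Finset.mem_range.2 (by omega))
    _ ≤ ∑ m ∈ Finset.range n, ∑ k ∈ Finset.range (K + 1), bound m k :=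
        Finset.single_le_sum (f := fun m => ∑ k ∈ Finset.range (K + 1), bound m k)
          (fun i _ => Finset.sum_nonneg fun k _ => bound_nonneg i k) (Finset.mem_range.2 hm.2)

/-- The Chebyshev knots of degree `p`, continued beyond the index `p + 1` to a strictly increasing
sequence, so that the results on B-splines with simple knots apply. -/
noncomputable def chebyshevExtend (p i : ℕ) : ℝ :=
  if i ≤ p + 1 then chebyshevKnot (p + 1) i else i

lemma chebyshevKnot_lt {m i k : ℕ} (hik : i < k) (hk : k ≤ m) :
    chebyshevKnot m i < chebyshevKnot m k := by
  have hm : (0 : ℝ) < m := by exact_mod_cast (by omega : 0 < m)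
  refine neg_lt_neg (Real.cos_lt_cos_of_nonneg_of_le_pi (by positivity) ?_ (by gcongr))
  rw [div_le_iff₀ hm, mul_comm]
  gcongr

lemma strictMono_chebyshevExtend (p : ℕ) : StrictMono (chebyshevExtend p) := by
  intro i k hik
  unfold chebyshevExtend
  split_ifs with hi hk hk
  · exact chebyshevKnot_lt hik hk
  · exact (neg_le.1 (Real.neg_one_le_cos _)).trans_lt (by exact_mod_cast (by omega : 1 < k))
  · omega
  · exact_mod_cast hik

lemma chebyshevExtend_zero (p : ℕ) : chebyshevExtend p 0 = -1 := by
  simp [chebyshevExtend, chebyshevKnot]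

lemma chebyshevExtend_last (p : ℕ) : chebyshevExtend p (p + 1) = 1 := by
  have : ((p + 1 : ℕ) : ℝ) ≠ 0 := by positivity
  rw [chebyshevExtend, if_pos le_rfl, chebyshevKnot, mul_div_cancel_left₀ _ this, Real.cos_pi,
    neg_neg]

lemma transition_eq_integral_normBspline (p : ℕ) (x : ℝ) :
    transition p x = ∫ t in (-1 : ℝ)..x, (p + 1 : ℝ) * normBspline (chebyshevExtend p) p 0 t := by
  have hcongr : bspline (chebyshevKnot (p + 1)) p 0 = bspline (chebyshevExtend p) p 0 :=
    bspline_congr p 0 fun i _ h => by rw [chebyshevExtend, if_pos (by omega)]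
  have hlength : chebyshevExtend p (0 + p + 1) - chebyshevExtend p 0 = 2 := by
    rw [zero_add, chebyshevExtend_last, chebyshevExtend_zero]
    norm_num
  simp only [transition, hcongr, normBspline, hlength]
  congr 1 with t
  ring

lemma transition_of_le {p : ℕ} {x : ℝ} (hx : x ≤ -1) : transition p x = 0 := by
  rw [transition_eq_integral_normBspline, intervalIntegral.integral_symm,
    intervalIntegral.integral_of_le hx, ← integral_Ico_eq_integral_Ioc,
    setIntegral_eq_zero_of_forall_eq_zero, neg_zero]
  intro t ht
  rw [normBspline, bspline_of_lt (strictMono_chebyshevExtend p).monotone, zero_div, mul_zero]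
  exact ht.2.trans_eq (chebyshevExtend_zero p).symm

lemma transition_of_ge {p : ℕ} {x : ℝ} (hx : 1 ≤ x) : transition p x = 1 := by
  rw [transition_eq_integral_normBspline, intervalIntegral.integral_const_mul,
    integral_normBspline (strictMono_chebyshevExtend p) p 0 (chebyshevExtend_zero p).ge]
  · exact mul_one_div_cancel (by positivity)
  · rw [zero_add, chebyshevExtend_last]
    exact hx

lemma hasDerivAt_transition {p : ℕ} (hp : 1 ≤ p) (x : ℝ) :
    HasDerivAt (transition p) ((p + 1) * normBspline (chebyshevExtend p) p 0 x) x := by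
  obtain ⟨q, rfl⟩ : ∃ q, p = q + 1 := ⟨p - 1, by omega⟩
  have hcont := continuous_bspline_succ (strictMono_chebyshevExtend (q + 1)) q 0
  rw [funext (transition_eq_integral_normBspline (q + 1))]
  exact (Continuous.integral_hasStrictDerivAt (by unfold normBspline; fun_prop) (-1) x).hasDerivAt

lemma deriv_transition {p : ℕ} (hp : 1 ≤ p) : deriv (transition p) =
    fun x => (p + 1) * normBspline (chebyshevExtend p) p 0 x :=
  funext fun x => (hasDerivAt_transition hp x).deriv

lemma contDiff_transition {p : ℕ} (hp : 1 ≤ p) : ContDiff ℝ p (transition p) := by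
  have hdiff : Differentiable ℝ (transition p) := fun x =>
    (hasDerivAt_transition hp x).differentiableAt
  obtain ⟨q, rfl⟩ : ∃ q, p = q + 1 := ⟨p - 1, by omega⟩
  rw [Nat.cast_add, Nat.cast_one, contDiff_succ_iff_deriv, deriv_transition hp]
  exact ⟨hdiff, by simp, contDiff_const.mul
    ((contDiff_bspline_succ (strictMono_chebyshevExtend _) q 0).div_const _)⟩

lemma exists_abs_iteratedDeriv_transition_le {p : ℕ} (hp : 1 ≤ p) (K : ℕ) :
    ∃ M : ℝ, ∀ k ≤ K, ∀ x ∈ Icc (-1) 1, x ∉ range (chebyshevExtend p) →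
      |iteratedDeriv k (transition p) x| ≤ M := by
  obtain ⟨M₀, hM₀⟩ := isCompact_Icc.exists_bound_of_continuousOn (s := Icc (-1 : ℝ) 1)
    (contDiff_transition hp).continuous.continuousOn
  obtain ⟨M₁, hM₁⟩ := exists_abs_iteratedDeriv_bspline_le
    (strictMono_chebyshevExtend p).monotone p 0 (p + 1) K
  have hlength : chebyshevExtend p (0 + p + 1) - chebyshevExtend p 0 = 2 := by
    rw [zero_add, chebyshevExtend_last, chebyshevExtend_zero]
    norm_num
  refine ⟨max M₀ ((p + 1) * (M₁ / 2)), fun k hk x hx hx' => ?_⟩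
  rcases k with _ | k
  · exact (hM₀ x hx).trans (le_max_left _ _)
  · refine le_trans ?_ (le_max_right _ _)
    simp only [iteratedDeriv_succ', deriv_transition hp, normBspline, iteratedDeriv_const_mul_field,
      iteratedDeriv_div_const, abs_mul, abs_div, hlength]
    rw [abs_of_nonneg (by positivity : (0 : ℝ) ≤ p + 1), abs_two]
    gcongr
    refine hM₁ k (by omega) x ?_ hx'
    rwa [chebyshevExtend_zero, chebyshevExtend_last]

lemma contDiffAt_succ_of_deriv {f : ℝ → ℝ} {n : ℕ} {x : ℝ} (hf : Differentiable ℝ f)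
    (hf' : ContDiffAt ℝ n (deriv f) x) : ContDiffAt ℝ (n + 1) f x :=
  contDiffAt_succ_iff_hasFDerivAt.2 ⟨fun y => ContinuousLinearMap.toSpanSingleton ℝ (deriv f y),
    ⟨univ, Filter.univ_mem, fun y _ => (hf y).hasDerivAt.hasFDerivAt⟩,
    (ContinuousLinearMap.toSpanSingletonCLE (𝕜 := ℝ) (E := ℝ)).contDiff.contDiffAt.comp x hf'⟩

lemma contDiffAt_transition {p : ℕ} (hp : 1 ≤ p) {x : ℝ} (hx : x ∉ range (chebyshevExtend p))
    (n : ℕ) : ContDiffAt ℝ (n + 1) (transition p) x := by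
  refine contDiffAt_succ_of_deriv (fun y => (hasDerivAt_transition hp y).differentiableAt) ?_
  rw [deriv_transition hp]
  exact contDiffAt_const.mul ((contDiffAt_bspline hx p 0).div_const _)

/-! ### The dual kernels -/

section ProdSub

variable {ι : Type*} (s : Finset ι) (η : ι → ℝ)

lemma contDiff_prod_sub {n : WithTop ℕ∞} : ContDiff ℝ n fun x => ∏ i ∈ s, (x - η i) :=
  contDiff_prod fun _ _ => contDiff_id.sub contDiff_const

lemma iteratedDeriv_succ_prod_sub [DecidableEq ι] (k : ℕ) (x : ℝ) :
    iteratedDeriv (k + 1) (fun x => ∏ i ∈ s, (x - η i)) x =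
      ∑ i ∈ s, iteratedDeriv k (fun x => ∏ j ∈ s.erase i, (x - η j)) x := by
  have deriv_prod : deriv (fun x => ∏ i ∈ s, (x - η i)) =
      fun x => ∑ i ∈ s, ∏ j ∈ s.erase i, (x - η j) := funext fun y =>
    ((HasDerivAt.fun_finsetProd fun i _ => (hasDerivAt_id y).sub_const (η i)).congr_deriv
      (by simp)).deriv
  rw [iteratedDeriv_succ', deriv_prod]
  exact iteratedDeriv_fun_sum fun i _ => (contDiff_prod_sub (s.erase i) η).contDiffAt

lemma abs_iteratedDeriv_prod_sub_le {ℓ x : ℝ} (hℓ : 0 < ℓ) (k : ℕ) :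
    ∀ s : Finset ι, (∀ i ∈ s, |x - η i| ≤ ℓ) →
      |iteratedDeriv k (fun x => ∏ i ∈ s, (x - η i)) x| ≤
        s.card.factorial * (ℓ ^ s.card / ℓ ^ k) := by
  classical
  induction k with
  | zero =>
    intro s hs
    rw [iteratedDeriv_zero, Finset.abs_prod, pow_zero, div_one]
    calc ∏ i ∈ s, |x - η i| ≤ ℓ ^ s.card :=
          (Finset.prod_le_prod (fun _ _ => abs_nonneg _) hs).trans_eq (Finset.prod_const ℓ)
      _ ≤ s.card.factorial * ℓ ^ s.card :=
          le_mul_of_one_le_left (by positivity) (by exact_mod_cast s.card.factorial_pos)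
  | succ k ih =>
    intro s hs
    rw [iteratedDeriv_succ_prod_sub]
    have hterm : ∀ i ∈ s, |iteratedDeriv k (fun x => ∏ j ∈ s.erase i, (x - η j)) x| ≤
        (s.card - 1).factorial * (ℓ ^ s.card / ℓ ^ (k + 1)) := fun i hi => by
      have hcard : ℓ ^ s.card = ℓ ^ (s.card - 1) * ℓ := by
        rw [← pow_succ, Nat.sub_add_cancel (Finset.card_pos.2 ⟨i, hi⟩)]
      have := ih (s.erase i) fun j hj => hs j (Finset.mem_of_mem_erase hj)
      rwa [Finset.card_erase_of_mem hi, ← mul_div_mul_right _ _ hℓ.ne', ← hcard, ← pow_succ] at this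
    refine (Finset.abs_sum_le_sum_abs _ _).trans ((Finset.sum_le_card_nsmul _ _ _ hterm).trans ?_)
    rcases s.eq_empty_or_nonempty with rfl | hne
    · simp [hℓ.le]
    · rw [nsmul_eq_mul, ← mul_assoc, ← Nat.cast_mul, Nat.mul_factorial_pred hne.card_pos.ne']

lemma iteratedDeriv_card_prod_sub (n : ℕ) :
    ∀ s : Finset ι, s.card = n →
      iteratedDeriv n (fun x => ∏ i ∈ s, (x - η i)) = fun _ => (n.factorial : ℝ) := by
  classical
  induction n with
  | zero =>
    intro s hs
    simp [Finset.card_eq_zero.1 hs]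
  | succ n ih =>
    intro s hs
    funext x
    rw [iteratedDeriv_succ_prod_sub, Finset.sum_congr rfl fun i hi => congrFun (ih (s.erase i)
      (by rw [Finset.card_erase_of_mem hi, hs, Nat.add_sub_cancel])) x, Finset.sum_const, hs,
      Nat.factorial_succ, nsmul_eq_mul, Nat.cast_mul]

lemma iteratedDeriv_card_pred_prod_sub (n : ℕ) :
    ∀ s : Finset ι, s.card = n + 1 → iteratedDeriv n (fun x => ∏ i ∈ s, (x - η i)) =
      fun x => ((n + 1).factorial : ℝ) * x - n.factorial * ∑ i ∈ s, η i := by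
  classical
  induction n with
  | zero =>
    intro s hs
    obtain ⟨i, rfl⟩ := Finset.card_eq_one.1 hs
    simp
  | succ n ih =>
    intro s hs
    funext x
    have hterm : ∀ i ∈ s, iteratedDeriv n (fun x => ∏ j ∈ s.erase i, (x - η j)) x =
        (n + 1).factorial * x - n.factorial * (∑ j ∈ s, η j - η i) := fun i hi => by
      rw [ih (s.erase i) (by rw [Finset.card_erase_of_mem hi, hs, Nat.add_sub_cancel]),
        Finset.sum_erase_eq_sub hi]
    rw [iteratedDeriv_succ_prod_sub, Finset.sum_congr rfl hterm, Finset.sum_sub_distrib,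
      ← Finset.mul_sum, ← Finset.mul_sum, Finset.sum_sub_distrib, Finset.sum_const,
      Finset.sum_const, hs, Nat.factorial_succ (n + 1), Nat.factorial_succ n, nsmul_eq_mul,
      nsmul_eq_mul]
    push_cast
    ring

end ProdSub

/-- The polynomial factor `φ_j(x) = (x - ξ_{j+1}) ⋯ (x - ξ_{j+p}) / p!` of the dual kernel. -/
noncomputable def dualPoly (ξ : ℕ → ℝ) (p j : ℕ) (x : ℝ) : ℝ :=
  (∏ k ∈ Finset.range p, (x - ξ (j + k + 1))) / p.factorial

/-- The mean of the interior knots of `B_{j,p}`. It is the coefficient of `B_{j,p}` in the expansion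
of the identity function. -/
noncomputable def grevilleAbscissa (ξ : ℕ → ℝ) (p j : ℕ) : ℝ :=
  (∑ k ∈ Finset.range p, ξ (j + k + 1)) / p

/-- The affine map taking `[a, b]` onto the interval `[-1, 1]` on which the transition function
lives. -/
noncomputable def rescale (a b x : ℝ) : ℝ :=
  (2 * x - a - b) / (b - a)

section Rescale

variable {a b : ℝ} (hab : a < b)
include hab

lemma rescale_mem_Icc {x : ℝ} (hx : x ∈ Icc a b) : rescale a b x ∈ Icc (-1 : ℝ) 1 := by
  have : 0 < b - a := sub_pos.2 hab
  exact ⟨(le_div_iff₀ this).2 (by linarith [hx.1]), (div_le_iff₀ this).2 (by linarith [hx.2])⟩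

lemma rescale_le_neg_one {x : ℝ} (hx : x ≤ a) : rescale a b x ≤ -1 :=
  (div_le_iff₀ (sub_pos.2 hab)).2 (by linarith)

lemma one_le_rescale {x : ℝ} (hx : b ≤ x) : 1 ≤ rescale a b x :=
  (le_div_iff₀ (sub_pos.2 hab)).2 (by linarith)

lemma injective_rescale : Function.Injective (rescale a b) := fun x y hxy => by
  have : 2 * x - a - b = 2 * y - a - b := (div_left_inj' (sub_pos.2 hab).ne').1 hxy
  linarith

end Rescale

lemma contDiff_rescale (a b : ℝ) {n : WithTop ℕ∞} : ContDiff ℝ n (rescale a b) :=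
  (((contDiff_const.mul contDiff_id).sub contDiff_const).sub contDiff_const).div_const _

lemma iteratedDeriv_comp_rescale (a b : ℝ) (f : ℝ → ℝ) (n : ℕ) :
    iteratedDeriv n (fun x => f (rescale a b x)) =
      fun x => (2 / (b - a)) ^ n * iteratedDeriv n f (rescale a b x) := by
  have hrescale : rescale a b = fun x => 2 / (b - a) * x + -(a + b) / (b - a) := by
    funext x
    unfold rescale
    ring
  rw [hrescale]
  induction n with
  | zero => simp
  | succ n ih =>
    funext x
    rw [iteratedDeriv_succ, ih, deriv_const_mul_field, iteratedDeriv_succ,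
      deriv_comp_mul_left _ (fun y => iteratedDeriv n f (y + -(a + b) / (b - a))) x,
      deriv_comp_add_const, smul_eq_mul]
    ring

section DualPoly

variable {ξ : ℕ → ℝ}

lemma contDiff_dualPoly (ξ : ℕ → ℝ) (p j : ℕ) {n : WithTop ℕ∞} : ContDiff ℝ n (dualPoly ξ p j) :=
  (contDiff_prod_sub (Finset.range p) fun k => ξ (j + k + 1)).div_const _

lemma abs_iteratedDeriv_dualPoly_le (hξ : Monotone ξ) {p j : ℕ} (hj : ξ j < ξ (j + p + 1))
    {x : ℝ} (hx : x ∈ Icc (ξ j) (ξ (j + p + 1))) (k : ℕ) :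
    |iteratedDeriv k (dualPoly ξ p j) x| ≤
      (ξ (j + p + 1) - ξ j) ^ p / (ξ (j + p + 1) - ξ j) ^ k := by
  have hfact : (0 : ℝ) < p.factorial := by positivity
  have hdist : ∀ i ∈ Finset.range p, |x - ξ (j + i + 1)| ≤ ξ (j + p + 1) - ξ j := fun i hi => by
    have hi := Finset.mem_range.1 hi
    exact abs_sub_le_of_le_of_le hx.1 hx.2 (hξ (by omega)) (hξ (by omega))
  have := abs_iteratedDeriv_prod_sub_le (fun k => ξ (j + k + 1)) (sub_pos.2 hj) k _ hdist
  unfold dualPoly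
  rw [iteratedDeriv_div_const, abs_div, abs_of_pos hfact, div_le_iff₀ hfact, mul_comm]
  rwa [Finset.card_range] at this

lemma iteratedDeriv_dualPoly (ξ : ℕ → ℝ) (p j : ℕ) :
    iteratedDeriv p (dualPoly ξ p j) = fun _ => 1 := by
  unfold dualPoly
  funext x
  rw [iteratedDeriv_div_const, iteratedDeriv_card_prod_sub _ p _ (Finset.card_range p)]
  exact div_self (by positivity)

lemma iteratedDeriv_dualPoly_succ (ξ : ℕ → ℝ) (p j : ℕ) :
    iteratedDeriv p (dualPoly ξ (p + 1) j) = fun x => x - grevilleAbscissa ξ (p + 1) j := by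
  unfold dualPoly grevilleAbscissa
  funext x
  rw [iteratedDeriv_div_const,
    iteratedDeriv_card_pred_prod_sub _ p _ (Finset.card_range (p + 1)), Nat.factorial_succ]
  push_cast
  field_simp

end DualPoly

/-- The points at which the derivative of order `p + 1` of the dual kernel may fail to exist: the
Chebyshev knots transported to the support of `B_{j,p}`. -/
def singularSet (ξ : ℕ → ℝ) (p j : ℕ) : Set ℝ :=
  rescale (ξ j) (ξ (j + p + 1)) ⁻¹' range (chebyshevExtend p)

lemma countable_singularSet {ξ : ℕ → ℝ} {p j : ℕ} (hj : ξ j < ξ (j + p + 1)) :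
    (singularSet ξ p j).Countable :=
  (countable_range _).preimage (injective_rescale hj)

lemma dualKernel_eq_mul (ξ : ℕ → ℝ) (p j : ℕ) : dualKernel ξ p j =
    fun x => transition p (rescale (ξ j) (ξ (j + p + 1)) x) * dualPoly ξ p j x :=
  rfl

lemma contDiff_dualKernel {p : ℕ} (hp : 1 ≤ p) (ξ : ℕ → ℝ) (j : ℕ) :
    ContDiff ℝ p (dualKernel ξ p j) :=
  ((contDiff_transition hp).comp (contDiff_rescale _ _)).mul (contDiff_dualPoly ξ p j)

lemma hasDerivAt_iteratedDeriv_dualKernel {ξ : ℕ → ℝ} {p j : ℕ} (hp : 1 ≤ p) {x : ℝ}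
    (hx : x ∉ singularSet ξ p j) :
    HasDerivAt (iteratedDeriv p (dualKernel ξ p j)) (iteratedDeriv (p + 1) (dualKernel ξ p j) x)
      x := by
  have hcontDiffAt : ContDiffAt ℝ (p + 1) (dualKernel ξ p j) x :=
    ((contDiffAt_transition hp hx p).comp x (contDiff_rescale _ _).contDiffAt).mul
      (contDiff_dualPoly ξ p j).contDiffAt
  rw [iteratedDeriv_succ]
  refine DifferentiableAt.hasDerivAt ?_
  rw [← iteratedDerivWithin_univ, ← differentiableWithinAt_univ]
  rw [← contDiffWithinAt_univ] at hcontDiffAt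
  refine hcontDiffAt.differentiableWithinAt_iteratedDerivWithin ?_ (by simp [uniqueDiffOn_univ])
  exact_mod_cast Nat.lt_succ_self p

/-- In Leibniz' formula the powers of the length `ξ_{j+p+1} - ξ_j` of the support add up to `-1`
in every term. -/
lemma exists_abs_iteratedDeriv_dualKernel_le {p : ℕ} (hp : 1 ≤ p) :
    ∃ N : ℝ, 0 ≤ N ∧ ∀ (ξ : ℕ → ℝ) (j : ℕ), Monotone ξ → ξ j < ξ (j + p + 1) →
      ∀ x ∈ Icc (ξ j) (ξ (j + p + 1)), x ∉ singularSet ξ p j →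
        |iteratedDeriv (p + 1) (dualKernel ξ p j) x| ≤ N / (ξ (j + p + 1) - ξ j) := by
  obtain ⟨M, hM⟩ := exists_abs_iteratedDeriv_transition_le hp (p + 1)
  refine ⟨3 ^ (p + 1) * |M|, by positivity, fun ξ j hξ hj x hx hxS => ?_⟩
  set ℓ := ξ (j + p + 1) - ξ j with hℓ
  have : 0 < ℓ := sub_pos.2 hj
  have hterm : ∀ i ∈ Finset.range (p + 2), |((p + 1).choose i : ℝ) *
      iteratedDeriv i (fun x => transition p (rescale (ξ j) (ξ (j + p + 1)) x)) x *
        iteratedDeriv (p + 1 - i) (dualPoly ξ p j) x| ≤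
      |M| / ℓ * (2 ^ i * 1 ^ (p + 1 - i) * (p + 1).choose i) := fun i hi => by
    have hi : i ≤ p + 1 := by simpa [Nat.lt_succ_iff] using hi
    have htrans := (hM i hi _ (rescale_mem_Icc hj hx) hxS).trans (le_abs_self M)
    have hpow : (2 / ℓ) ^ i * (ℓ ^ p / ℓ ^ (p + 1 - i)) = 2 ^ i / ℓ := by
      rw [div_pow, div_mul_div_comm, ← pow_add, Nat.add_sub_cancel' hi, pow_succ,
        mul_comm (ℓ ^ p) ℓ, mul_div_mul_right _ _ (by positivity)]
    rw [iteratedDeriv_comp_rescale, abs_mul, abs_mul, abs_mul, Nat.abs_cast, ← hℓ,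
      abs_of_nonneg (by positivity : 0 ≤ (2 / ℓ) ^ i)]
    calc ((p + 1).choose i : ℝ) * ((2 / ℓ) ^ i * |iteratedDeriv i (transition p) _|) *
          |iteratedDeriv (p + 1 - i) (dualPoly ξ p j) x|
        ≤ (p + 1).choose i * ((2 / ℓ) ^ i * |M|) * (ℓ ^ p / ℓ ^ (p + 1 - i)) := by
          gcongr
          exact abs_iteratedDeriv_dualPoly_le hξ hj hx _
      _ = (p + 1).choose i * |M| * ((2 / ℓ) ^ i * (ℓ ^ p / ℓ ^ (p + 1 - i))) := by ring
      _ = _ := by rw [hpow]; ring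
  have hsmooth : ContDiffAt ℝ ((p + 1 : ℕ) : WithTop ℕ∞)
      (fun x => transition p (rescale (ξ j) (ξ (j + p + 1)) x)) x := by
    exact_mod_cast (contDiffAt_transition hp hxS p).comp x (contDiff_rescale _ _).contDiffAt
  rw [dualKernel_eq_mul, iteratedDeriv_fun_mul hsmooth (contDiff_dualPoly ξ p j).contDiffAt]
  refine (Finset.abs_sum_le_sum_abs _ _).trans ((Finset.sum_le_sum hterm).trans_eq ?_)
  rw [← Finset.mul_sum, ← add_pow]
  ring

section Moments

variable {ξ : ℕ → ℝ} {p j n : ℕ} (hp : 1 ≤ p) (hj : ξ j < ξ (j + p + 1))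
include hp hj

lemma iteratedDeriv_dualKernel_left (hn : n ≤ p) :
    iteratedDeriv n (dualKernel ξ p j) (ξ j) = 0 := by
  have eqOn_zero : EqOn (dualKernel ξ p j) (fun _ => 0) (Iio (ξ j)) := fun x hx => by
    rw [dualKernel_eq_mul]
    simp only [transition_of_le (rescale_le_neg_one hj (le_of_lt hx)), zero_mul]
  have := (eqOn_zero.iteratedDeriv_of_isOpen isOpen_Iio n).closure
    ((contDiff_dualKernel hp ξ j).continuous_iteratedDeriv n (by exact_mod_cast hn))
    (contDiff_const.continuous_iteratedDeriv n le_rfl)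
  rw [closure_Iio] at this
  rw [this self_mem_Iic, iteratedDeriv_fun_const_zero]

lemma iteratedDeriv_dualKernel_right (hn : n ≤ p) :
    iteratedDeriv n (dualKernel ξ p j) (ξ (j + p + 1)) =
      iteratedDeriv n (dualPoly ξ p j) (ξ (j + p + 1)) := by
  have eqOn_dualPoly : EqOn (dualKernel ξ p j) (dualPoly ξ p j) (Ioi (ξ (j + p + 1))) :=
    fun x hx => by
      rw [dualKernel_eq_mul]
      simp only [transition_of_ge (one_le_rescale hj (le_of_lt hx)), one_mul]
  have := (eqOn_dualPoly.iteratedDeriv_of_isOpen isOpen_Ioi n).closure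
    ((contDiff_dualKernel hp ξ j).continuous_iteratedDeriv n (by exact_mod_cast hn))
    ((contDiff_dualPoly ξ p j).continuous_iteratedDeriv n le_rfl)
  rw [closure_Ioi] at this
  exact this self_mem_Ici

variable (hξ : Monotone ξ)
include hξ

lemma intervalIntegrable_iteratedDeriv_dualKernel :
    IntervalIntegrable (iteratedDeriv (p + 1) (dualKernel ξ p j)) volume (ξ j) (ξ (j + p + 1)) := by
  obtain ⟨N, -, hN⟩ := exists_abs_iteratedDeriv_dualKernel_le hp
  rw [iteratedDeriv_succ]
  refine (intervalIntegrable_const (c := N / (ξ (j + p + 1) - ξ j))).mono_fun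
    (measurable_deriv _).aestronglyMeasurable ?_
  rw [uIoc_of_le hj.le, ← iteratedDeriv_succ]
  filter_upwards [ae_restrict_of_ae ((countable_singularSet hj).ae_notMem volume),
    ae_restrict_mem measurableSet_Ioc] with x hxS hx
  exact (hN ξ j hξ hj x (Ioc_subset_Icc_self hx) hxS).trans (le_abs_self _)

lemma dualFunctional_one : dualFunctional ξ p j (fun _ => 1) = 1 := by
  simp only [dualFunctional, one_mul]
  rw [integral_eq_of_hasDerivAt_off_countable _ _ (countable_singularSet hj)
    ((contDiff_dualKernel hp ξ j).continuous_iteratedDeriv p le_rfl).continuousOn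
    (fun x hx => hasDerivAt_iteratedDeriv_dualKernel hp hx.2)
    (intervalIntegrable_iteratedDeriv_dualKernel hp hj hξ),
    iteratedDeriv_dualKernel_left hp hj le_rfl, iteratedDeriv_dualKernel_right hp hj le_rfl,
    iteratedDeriv_dualPoly, sub_zero]

/-- Integration by parts: `s ↦ s D^p ψ_j - D^{p-1} ψ_j` is a primitive of the integrand. -/
lemma dualFunctional_id : dualFunctional ξ p j (fun s => s) = grevilleAbscissa ξ p j := by
  obtain ⟨q, rfl⟩ : ∃ q, p = q + 1 := ⟨p - 1, by omega⟩
  set ψ := dualKernel ξ (q + 1) j with hψ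
  have hsmooth := contDiff_dualKernel hp ξ j
  have hcont : ∀ n ≤ q + 1, Continuous (iteratedDeriv n ψ) := fun n hn =>
    hsmooth.continuous_iteratedDeriv n (by exact_mod_cast hn)
  have hderiv : ∀ x ∉ singularSet ξ (q + 1) j,
      HasDerivAt (fun s => s * iteratedDeriv (q + 1) ψ s - iteratedDeriv q ψ s)
        (x * iteratedDeriv (q + 2) ψ x) x := fun x hx => by
    have hderiv_q : HasDerivAt (iteratedDeriv q ψ) (iteratedDeriv (q + 1) ψ x) x := by
      rw [iteratedDeriv_succ]
      exact (hsmooth.differentiable_iteratedDeriv q (by exact_mod_cast q.lt_succ_self) x).hasDerivAt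
    exact (((hasDerivAt_id x).mul (hasDerivAt_iteratedDeriv_dualKernel hp hx)).sub
      hderiv_q).congr_deriv (by simp only [id, hψ]; ring)
  have hint : IntervalIntegrable (fun s => s * iteratedDeriv (q + 2) ψ s) volume (ξ j)
      (ξ (j + (q + 1) + 1)) :=
    (intervalIntegrable_iteratedDeriv_dualKernel hp hj hξ).continuousOn_mul continuousOn_id
  have hcontOn : Continuous fun s => s * iteratedDeriv (q + 1) ψ s - iteratedDeriv q ψ s :=
    (continuous_id.mul (hcont _ le_rfl)).sub (hcont q q.le_succ)
  rw [dualFunctional, integral_eq_of_hasDerivAt_off_countable _ _ (countable_singularSet hj)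
    hcontOn.continuousOn (fun x hx => hderiv x hx.2) hint,
    iteratedDeriv_dualKernel_left hp hj le_rfl, iteratedDeriv_dualKernel_right hp hj le_rfl,
    iteratedDeriv_dualKernel_left hp hj q.le_succ, iteratedDeriv_dualKernel_right hp hj q.le_succ,
    iteratedDeriv_dualPoly, iteratedDeriv_dualPoly_succ]
  ring

end Moments

/-- The primitive of `v` vanishing at `a`. -/
noncomputable def primitive (a : ℝ) (v : ℝ → ℝ) (x : ℝ) : ℝ :=
  ∫ t in a..x, v t

/-- On integrable functions, the functional `L` is the integral over `(a, b)` against a measurable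
density bounded by `M`. The density is bounded everywhere, not only on `(a, b)`. -/
def HasBoundedDensity (L : (ℝ → ℝ) → ℝ) (a b M : ℝ) : Prop :=
  ∃ κ : ℝ → ℝ, Measurable κ ∧ (∀ s, |κ s| ≤ M) ∧
    ∀ v, IntervalIntegrable v volume a b → L v = ∫ s in a..b, κ s * v s

section Primitive

variable {κ v : ℝ → ℝ} {a b c : ℝ}

lemma absolutelyContinuousOnInterval_primitive (hv : IntervalIntegrable v volume a b)
    (hc : c ∈ uIcc a b) : AbsolutelyContinuousOnInterval (primitive c v) a b :=
  hv.absolutelyContinuousOnInterval_intervalIntegral hc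

lemma intervalIntegrable_primitive (hv : IntervalIntegrable v volume a b) :
    IntervalIntegrable (primitive a v) volume a b :=
  (absolutelyContinuousOnInterval_primitive hv left_mem_uIcc).continuousOn.intervalIntegrable

lemma intervalIntegrable_iterate_primitive (hv : IntervalIntegrable v volume a b) (k : ℕ) :
    IntervalIntegrable ((primitive a)^[k] v) volume a b := by
  induction k with
  | zero => exact hv
  | succ k ih =>
    rw [Function.iterate_succ_apply']
    exact intervalIntegrable_primitive ih

lemma ae_deriv_primitive (hv : IntervalIntegrable v volume a b) (hc : c ∈ uIcc a b) :
    ∀ᵐ x, x ∈ uIoc a b → deriv (primitive c v) x = v x := by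
  filter_upwards [hv.ae_hasDerivAt_integral] with x hx hxab
  exact (hx (uIoc_subset_uIcc hxab) c hc).deriv

lemma primitive_eq_add_primitive {x : ℝ} (hv : IntervalIntegrable v volume c b) (ha : a ∈ uIcc c b)
    (hx : x ∈ uIcc c b) : primitive c v x = primitive c v a + primitive a v x :=
  (intervalIntegral.integral_add_adjacent_intervals
    (hv.mono_set (uIcc_subset_uIcc left_mem_uIcc ha))
    (hv.mono_set (uIcc_subset_uIcc ha hx))).symm

lemma primitive_primitive_eq_add_affine {x : ℝ} (hv : IntervalIntegrable v volume c b)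
    (ha : a ∈ uIcc c b) (hx : x ∈ uIcc c b) :
    primitive c (primitive c v) x = primitive a (primitive a v) x +
      (primitive c (primitive c v) a - primitive c v a * a + primitive c v a * x) := by
  have hsub : uIcc a x ⊆ uIcc c b := uIcc_subset_uIcc ha hx
  have hint : IntervalIntegrable (primitive a v) volume a x :=
    intervalIntegrable_primitive (hv.mono_set hsub)
  have hshift : primitive a (primitive c v) x =
      primitive c v a * (x - a) + primitive a (primitive a v) x := by
    calc primitive a (primitive c v) x
        = ∫ s in a..x, (primitive c v a + primitive a v s) :=
          intervalIntegral.integral_congr fun s hs => primitive_eq_add_primitive hv ha (hsub hs)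
      _ = _ := by
          rw [intervalIntegral.integral_add intervalIntegrable_const hint,
            intervalIntegral.integral_const, smul_eq_mul, mul_comm]
          rfl
  rw [primitive_eq_add_primitive (intervalIntegrable_primitive hv) ha hx, hshift]
  ring

/-- Integration by parts: the product of the primitives vanishing at `b` and at `a` vanishes at both
end points. -/
lemma integral_mul_primitive (hκ : IntervalIntegrable κ volume a b)
    (hv : IntervalIntegrable v volume a b) :
    ∫ s in a..b, κ s * primitive a v s = ∫ s in a..b, -primitive b κ s * v s := by
  have parts := (absolutelyContinuousOnInterval_primitive hκ
    right_mem_uIcc).integral_mul_deriv_eq_deriv_mul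
      (absolutelyContinuousOnInterval_primitive hv left_mem_uIcc)
  have hleft : ∫ s in a..b, deriv (primitive b κ) s * primitive a v s =
      ∫ s in a..b, κ s * primitive a v s := by
    refine intervalIntegral.integral_congr_ae ?_
    filter_upwards [ae_deriv_primitive hκ right_mem_uIcc] with s hs hsab
    rw [hs hsab]
  have hright : ∫ s in a..b, primitive b κ s * deriv (primitive a v) s =
      ∫ s in a..b, primitive b κ s * v s := by
    refine intervalIntegral.integral_congr_ae ?_
    filter_upwards [ae_deriv_primitive hv left_mem_uIcc] with s hs hsab
    rw [hs hsab]
  have hb : primitive b κ b = 0 := intervalIntegral.integral_same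
  have ha : primitive a v a = 0 := intervalIntegral.integral_same
  rw [hleft, hright, hb, ha, zero_mul, mul_zero, sub_zero, zero_sub] at parts
  simp only [neg_mul, intervalIntegral.integral_neg, parts, neg_neg]

end Primitive

lemma abs_indicator_le {E : Set ℝ} {f : ℝ → ℝ} {M x : ℝ} (hM : 0 ≤ M) (hf : x ∈ E → |f x| ≤ M) :
    |E.indicator f x| ≤ M := by
  rw [← Real.norm_eq_abs, norm_indicator_eq_indicator_norm]
  exact indicator_apply_le' hf fun _ => hM

namespace HasBoundedDensity

variable {L : (ℝ → ℝ) → ℝ} {a b M : ℝ}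

lemma mono {M' : ℝ} (hL : HasBoundedDensity L a b M) (hM : M ≤ M') :
    HasBoundedDensity L a b M' := by
  obtain ⟨κ, hκ, hκM, hLκ⟩ := hL
  exact ⟨κ, hκ, fun s => (hκM s).trans hM, hLκ⟩

lemma comp_primitive (hL : HasBoundedDensity L a b M) (hab : a ≤ b) :
    HasBoundedDensity (fun v => L (primitive a v)) a b (M * (b - a)) := by
  obtain ⟨κ, hκ, hκM, hLκ⟩ := hL
  have hκint : ∀ c d, IntervalIntegrable κ volume c d := fun c d =>
    (intervalIntegrable_const (c := M)).mono_fun hκ.aestronglyMeasurable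
      (Filter.Eventually.of_forall fun x => (hκM x).trans (le_abs_self M))
  have hcont : Continuous (primitive b κ) := intervalIntegral.continuous_primitive hκint b
  refine ⟨(Ioc a b).indicator fun s => -primitive b κ s, hcont.measurable.neg.indicator
    measurableSet_Ioc, fun s => ?_, fun v hv => ?_⟩
  · have hM : 0 ≤ M := (abs_nonneg _).trans (hκM 0)
    refine abs_indicator_le (by nlinarith) fun hs => ?_
    rw [abs_neg]
    refine (intervalIntegral.norm_integral_le_of_norm_le_const (f := κ)
      fun x _ => hκM x).trans ?_
    gcongr
    rw [abs_sub_comm, abs_of_nonneg (sub_nonneg.2 hs.2)]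
    linarith [hs.1]
  · beta_reduce
    rw [hLκ _ (intervalIntegrable_primitive hv), integral_mul_primitive (hκint a b) hv]
    refine intervalIntegral.integral_congr_ae (Filter.Eventually.of_forall fun s hs => ?_)
    rw [uIoc_of_le hab] at hs
    rw [indicator_of_mem hs]

lemma comp_iterate_primitive (hL : HasBoundedDensity L a b M) (hab : a ≤ b) (k : ℕ) :
    HasBoundedDensity (fun v => L ((primitive a)^[k] v)) a b (M * (b - a) ^ k) := by
  induction k with
  | zero => simpa only [pow_zero, mul_one, Function.iterate_zero, id] using hL
  | succ k ih =>
    simpa only [pow_succ, mul_assoc, Function.iterate_succ_apply] using ih.comp_primitive hab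

lemma apply_add {v w : ℝ → ℝ} (hL : HasBoundedDensity L a b M)
    (hv : IntervalIntegrable v volume a b) (hw : IntervalIntegrable w volume a b) :
    L (fun s => v s + w s) = L v + L w := by
  obtain ⟨κ, hκ, hκM, hLκ⟩ := hL
  have hmul : ∀ u, IntervalIntegrable u volume a b →
      IntervalIntegrable (fun s => κ s * u s) volume a b := fun u hu =>
    ⟨hu.1.bdd_mul hκ.aestronglyMeasurable (Filter.Eventually.of_forall hκM),
      hu.2.bdd_mul hκ.aestronglyMeasurable (Filter.Eventually.of_forall hκM)⟩
  rw [hLκ _ (hv.add hw), hLκ v hv, hLκ w hw,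
    ← intervalIntegral.integral_add (hmul v hv) (hmul w hw)]
  simp only [mul_add]

lemma apply_const_mul {v : ℝ → ℝ} (hL : HasBoundedDensity L a b M)
    (hv : IntervalIntegrable v volume a b) (c : ℝ) : L (fun s => c * v s) = c * L v := by
  obtain ⟨κ, -, -, hLκ⟩ := hL
  rw [hLκ _ (hv.const_mul c), hLκ v hv, ← intervalIntegral.integral_const_mul]
  simp only [mul_left_comm]

lemma apply_congr {v w : ℝ → ℝ} (hL : HasBoundedDensity L a b M)
    (hv : IntervalIntegrable v volume a b) (hvw : EqOn w v (uIcc a b)) : L w = L v := by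
  obtain ⟨κ, -, -, hLκ⟩ := hL
  rw [hLκ w (hv.congr fun s hs => (hvw (uIoc_subset_uIcc hs)).symm), hLκ v hv]
  exact intervalIntegral.integral_congr fun s hs => by simp only [hvw hs]

end HasBoundedDensity

lemma exists_hasBoundedDensity_dualFunctional {p : ℕ} (hp : 1 ≤ p) :
    ∃ N : ℝ, 0 ≤ N ∧ ∀ (ξ : ℕ → ℝ) (j : ℕ) (a b : ℝ), Monotone ξ → ξ j < ξ (j + p + 1) →
      a ≤ ξ j → ξ (j + p + 1) ≤ b →
        HasBoundedDensity (dualFunctional ξ p j) a b (N / (ξ (j + p + 1) - ξ j)) := by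
  obtain ⟨N, hN, hbound⟩ := exists_abs_iteratedDeriv_dualKernel_le hp
  refine ⟨N, hN, fun ξ j a b hξ hj ha hb => ?_⟩
  set D := iteratedDeriv (p + 1) (dualKernel ξ p j) with hD
  have hDm : Measurable D := by
    rw [hD, iteratedDeriv_succ]
    exact measurable_deriv _
  set E := Ioc (ξ j) (ξ (j + p + 1)) \ singularSet ξ p j
  have hEm : MeasurableSet E := measurableSet_Ioc.diff (countable_singularSet hj).measurableSet
  refine ⟨E.indicator D, hDm.indicator hEm, fun s => ?_, fun v _ => ?_⟩
  · exact abs_indicator_le (div_nonneg hN (sub_nonneg.2 hj.le)) fun hs =>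
      hbound ξ j hξ hj s (Ioc_subset_Icc_self hs.1) hs.2
  · rw [dualFunctional, intervalIntegral.integral_of_le hj.le,
      intervalIntegral.integral_of_le (ha.trans (hj.le.trans hb)),
      setIntegral_eq_of_subset_of_forall_sdiff_eq_zero measurableSet_Ioc (Ioc_subset_Ioc ha hb)
        fun s hs => by rw [indicator_of_notMem fun h : s ∈ E => hs.2 h.1, zero_mul]]
    refine setIntegral_congr_ae measurableSet_Ioc ?_
    filter_upwards [(countable_singularSet hj).ae_notMem volume] with s hsS hs
    rw [indicator_of_mem (show s ∈ E from ⟨hs, hsS⟩), mul_comm]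

/-! ### Hilbert–Schmidt operators in one factor of a product -/

lemma eLpNorm_two_sq {X : Type*} [MeasurableSpace X] (μ : Measure X) (f : X → ℝ) :
    eLpNorm f 2 μ ^ 2 = ∫⁻ x, ‖f x‖ₑ ^ 2 ∂μ := by
  have := eLpNorm_nnreal_pow_eq_lintegral (f := f) (μ := μ) (p := 2) two_ne_zero
  simpa only [ENNReal.coe_ofNat, NNReal.coe_ofNat, ENNReal.rpow_ofNat] using this

lemma sq_rpow_half (x : ℝ≥0∞) : (x ^ 2) ^ (1 / 2 : ℝ) = x := by
  rw [← ENNReal.rpow_natCast_mul]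
  norm_num

lemma rpow_half_sq (x : ℝ≥0∞) : (x ^ (1 / 2 : ℝ)) ^ 2 = x := by
  rw [← ENNReal.rpow_mul_natCast]
  norm_num

lemma enorm_integral_mul_sq_le {X : Type*} [MeasurableSpace X] {μ : Measure X} {f g : X → ℝ}
    (hf : AEStronglyMeasurable f μ) (hg : AEStronglyMeasurable g μ) :
    ‖∫ x, f x * g x ∂μ‖ₑ ^ 2 ≤ (∫⁻ x, ‖f x‖ₑ ^ 2 ∂μ) * ∫⁻ x, ‖g x‖ₑ ^ 2 ∂μ := by
  have holder := ENNReal.lintegral_mul_le_Lp_mul_Lq μ Real.HolderConjugate.two_two hf.enorm hg.enorm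
  simp only [Pi.mul_apply, ENNReal.rpow_ofNat] at holder
  calc ‖∫ x, f x * g x ∂μ‖ₑ ^ 2 ≤ (∫⁻ x, ‖f x‖ₑ * ‖g x‖ₑ ∂μ) ^ 2 := by
        gcongr
        simpa only [enorm_mul] using enorm_integral_le_lintegral_enorm (μ := μ) fun x => f x * g x
    _ ≤ ((∫⁻ x, ‖f x‖ₑ ^ 2 ∂μ) ^ (1 / 2 : ℝ) * (∫⁻ x, ‖g x‖ₑ ^ 2 ∂μ) ^ (1 / 2 : ℝ)) ^ 2 := by
        gcongr
    _ = _ := by rw [mul_pow, rpow_half_sq, rpow_half_sq]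

section Kernel

variable {X X' Y : Type*} [MeasurableSpace X] [MeasurableSpace X'] [MeasurableSpace Y]
  {μ : Measure X} {μ' : Measure X'} {ν : Measure Y} [SFinite μ'] [SFinite ν]
  {K : X × X' → ℝ} {F : X' × Y → ℝ}

lemma aestronglyMeasurable_integral_kernel (hK : Measurable K)
    (hF : AEStronglyMeasurable F (μ'.prod ν)) :
    AEStronglyMeasurable (fun z : X × Y => ∫ s, K (z.1, s) * F (s, z.2) ∂μ') (μ.prod ν) := by
  have hproj : Measure.QuasiMeasurePreserving (fun q : (X × Y) × X' => (q.2, q.1.2))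
      ((μ.prod ν).prod μ') (μ'.prod ν) :=
    Measure.measurePreserving_swap.quasiMeasurePreserving.comp
      (Measure.quasiMeasurePreserving_snd.comp
        (measurePreserving_prodAssoc μ ν μ').quasiMeasurePreserving)
  exact AEStronglyMeasurable.integral_prod_right'
    (f := fun q : (X × Y) × X' => K (q.1.1, q.2) * F (q.2, q.1.2))
    ((hK.comp (by fun_prop)).aestronglyMeasurable.mul (hF.comp_quasiMeasurePreserving hproj))

lemma eLpNorm_integral_kernel_le {C : ℝ≥0∞} (hK : Measurable K)
    (hC : ∫⁻ x, ∫⁻ s, ‖K (x, s)‖ₑ ^ 2 ∂μ' ∂μ ≤ C ^ 2) (hF : AEStronglyMeasurable F (μ'.prod ν)) :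
    eLpNorm (fun z : X × Y => ∫ s, K (z.1, s) * F (s, z.2) ∂μ') 2 (μ.prod ν) ≤
      C * eLpNorm F 2 (μ'.prod ν) := by
  have hKsq : Measurable fun x => ∫⁻ s, ‖K (x, s)‖ₑ ^ 2 ∂μ' :=
    (hK.enorm.pow_const 2).lintegral_prod_right'
  have hFsq : AEMeasurable (fun z => ‖F z‖ₑ ^ 2) (μ'.prod ν) := hF.enorm.pow_const 2
  have hslice : ∀ᵐ z ∂μ.prod ν, AEStronglyMeasurable (fun s => F (s, z.2)) μ' :=
    Measure.quasiMeasurePreserving_snd.ae hF.prod_swap.prodMk_left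
  refine (ENNReal.pow_le_pow_left_iff two_ne_zero).1 ?_
  rw [mul_pow, eLpNorm_two_sq, eLpNorm_two_sq]
  calc ∫⁻ z, ‖∫ s, K (z.1, s) * F (s, z.2) ∂μ'‖ₑ ^ 2 ∂μ.prod ν
      ≤ ∫⁻ z, (∫⁻ s, ‖K (z.1, s)‖ₑ ^ 2 ∂μ') * ∫⁻ s, ‖F (s, z.2)‖ₑ ^ 2 ∂μ' ∂μ.prod ν := by
        refine lintegral_mono_ae ?_
        filter_upwards [hslice] with z hz
        exact enorm_integral_mul_sq_le (hK.comp measurable_prodMk_left).aestronglyMeasurable hz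
    _ = (∫⁻ x, ∫⁻ s, ‖K (x, s)‖ₑ ^ 2 ∂μ' ∂μ) * ∫⁻ y, ∫⁻ s, ‖F (s, y)‖ₑ ^ 2 ∂μ' ∂ν :=
        lintegral_prod_mul hKsq.aemeasurable hFsq.lintegral_prod_left'
    _ ≤ C ^ 2 * ∫⁻ z, ‖F z‖ₑ ^ 2 ∂μ'.prod ν := by
        rw [lintegral_prod_symm _ hFsq]
        gcongr

end Kernel

/-- For `v` integrable on `U`, the function `T v` is given on `I` by integration over `J` against a
kernel whose Hilbert–Schmidt norm in `L²(I × J)` is at most `C`. The formula holds at every point of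
`I`, since the operators `projC1` and `projC2` are defined pointwise. -/
def IsKernelOp (T : (ℝ → ℝ) → ℝ → ℝ) (U I J : Set ℝ) (C : ℝ≥0) : Prop :=
  ∃ K : ℝ × ℝ → ℝ, Measurable K ∧ ∫⁻ x in I, ∫⁻ s in J, ‖K (x, s)‖ₑ ^ 2 ≤ (C : ℝ≥0∞) ^ 2 ∧
    ∀ v, IntegrableOn v U → ∀ x ∈ I, T v x = ∫ s in J, K (x, s) * v s

namespace IsKernelOp

variable {T T' : (ℝ → ℝ) → ℝ → ℝ} {U U' I J : Set ℝ} {C : ℝ≥0}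

lemma congr (hT : IsKernelOp T U I J C) (hUU' : U ⊆ U')
    (h : ∀ v, IntegrableOn v U' → EqOn (T' v) (T v) I) : IsKernelOp T' U' I J C := by
  obtain ⟨K, hK, hKC, hTK⟩ := hT
  exact ⟨K, hK, hKC, fun v hv x hx => (h v hv hx).trans (hTK v (hv.mono_set hUU') x hx)⟩

lemma mono {C' : ℝ≥0} (hT : IsKernelOp T U I J C) (hCC' : C ≤ C') : IsKernelOp T U I J C' := by
  obtain ⟨K, hK, hKC, hTK⟩ := hT
  exact ⟨K, hK, hKC.trans (by gcongr), hTK⟩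

lemma memLp_prod {Y : Type*} [MeasurableSpace Y] {ν : Measure Y} [IsFiniteMeasure ν]
    {F : ℝ × Y → ℝ} (hT : IsKernelOp T U I J C) (hI : MeasurableSet I) (hU : volume U ≠ ∞)
    (hJU : J ⊆ U) (hF : MemLp F 2 ((volume.restrict U).prod ν)) :
    MemLp (fun z : ℝ × Y => T (fun t => F (t, z.2)) z.1) 2 ((volume.restrict I).prod ν) ∧
      eLpNorm (fun z : ℝ × Y => T (fun t => F (t, z.2)) z.1) 2 ((volume.restrict I).prod ν) ≤
        C * eLpNorm F 2 ((volume.restrict J).prod ν) := by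
  obtain ⟨K, hK, hKC, hTK⟩ := hT
  have : IsFiniteMeasure (volume.restrict U) := isFiniteMeasure_restrict.2 hU
  have hFJ : MemLp F 2 ((volume.restrict J).prod ν) :=
    hF.mono_measure (Measure.prod_mono (Measure.restrict_mono hJU le_rfl) le_rfl)
  have hslice : ∀ᵐ y ∂ν, IntegrableOn (fun t => F (t, y)) U :=
    (hF.integrable one_le_two).prod_left_ae
  have heq : (fun z : ℝ × Y => T (fun t => F (t, z.2)) z.1) =ᵐ[(volume.restrict I).prod ν]
      fun z => ∫ s in J, K (z.1, s) * F (s, z.2) := by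
    filter_upwards [Measure.quasiMeasurePreserving_fst.ae (ae_restrict_mem hI),
      Measure.quasiMeasurePreserving_snd.ae hslice] with z hzI hz using hTK _ hz _ hzI
  have hnorm := eLpNorm_integral_kernel_le (ν := ν) hK hKC hFJ.1
  rw [eLpNorm_congr_ae heq, memLp_congr_ae heq]
  exact ⟨⟨aestronglyMeasurable_integral_kernel hK hFJ.1,
    hnorm.trans_lt (ENNReal.mul_lt_top ENNReal.coe_lt_top hFJ.2)⟩, hnorm⟩

end IsKernelOp

lemma lintegral_lintegral_enorm_sq_le {K : ℝ × ℝ → ℝ} {I : Set ℝ} {a b A : ℝ}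
    (hK : ∀ x ∈ I, ∀ s, |K (x, s)| ≤ A) (hab : a ≤ b) (hIab : I ⊆ Ioo a b) :
    ∫⁻ x in I, ∫⁻ s in Ioo a b, ‖K (x, s)‖ₑ ^ 2 ≤ ENNReal.ofReal (A * (b - a)) ^ 2 := by
  have hKsq : ∀ x ∈ I, ∀ s, ‖K (x, s)‖ₑ ^ 2 ≤ ENNReal.ofReal A ^ 2 := fun x hx s => by
    rw [← ofReal_norm, Real.norm_eq_abs]
    gcongr
    exact hK x hx s
  calc ∫⁻ x in I, ∫⁻ s in Ioo a b, ‖K (x, s)‖ₑ ^ 2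
      ≤ ∫⁻ _ in I, ∫⁻ _ in Ioo a b, ENNReal.ofReal A ^ 2 :=
        setLIntegral_mono measurable_const fun x hx => lintegral_mono (hKsq x hx)
    _ = ENNReal.ofReal A ^ 2 * volume (Ioo a b) * volume I := by simp only [setLIntegral_const]
    _ ≤ ENNReal.ofReal A ^ 2 * volume (Ioo a b) * volume (Ioo a b) := by gcongr
    _ = ENNReal.ofReal (A * (b - a)) ^ 2 := by
        rw [Real.volume_Ioo, ENNReal.ofReal_mul' (sub_nonneg.2 hab)]
        ring

lemma isKernelOp_sum {ι : Type*} (s : Finset ι) {L : ι → (ℝ → ℝ) → ℝ} {β : ι → ℝ → ℝ} {I : Set ℝ}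
    {a b M N : ℝ} {C : ℝ≥0} (hL : ∀ i ∈ s, HasBoundedDensity (L i) a b M)
    (hβ : ∀ i ∈ s, Measurable (β i)) (hN : ∀ i ∈ s, ∀ x ∈ I, |β i x| ≤ N) (hab : a ≤ b)
    (hIab : I ⊆ Ioo a b) (hC : s.card * (M * N) * (b - a) ≤ C) :
    IsKernelOp (fun v x => ∑ i ∈ s, L i v * β i x) (Ioo a b) I (Ioo a b) C := by
  choose! κ hκ hκM hLκ using hL
  have hbound : ∀ x ∈ I, ∀ t, |∑ i ∈ s, β i x * κ i t| ≤ s.card * (M * N) := fun x hx t => by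
    rw [← nsmul_eq_mul]
    refine (Finset.abs_sum_le_sum_abs _ _).trans (Finset.sum_le_card_nsmul _ _ _ fun i hi => ?_)
    rw [abs_mul, mul_comm]
    exact mul_le_mul (hκM i hi t) (hN i hi x hx) (abs_nonneg _) ((abs_nonneg _).trans (hκM i hi t))
  refine ⟨fun z => ∑ i ∈ s, β i z.1 * κ i z.2, Finset.measurable_fun_sum s fun i hi =>
    ((hβ i hi).comp measurable_fst).mul ((hκ i hi).comp measurable_snd), ?_, fun v hv x _ => ?_⟩
  · refine (lintegral_lintegral_enorm_sq_le
      (K := fun z => ∑ i ∈ s, β i z.1 * κ i z.2) hbound hab hIab).trans ?_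
    gcongr
    exact ENNReal.ofReal_le_of_le_toReal hC
  · have hκv : ∀ i ∈ s, IntegrableOn (fun t => κ i t * v t) (Ioo a b) := fun i hi =>
      hv.bdd_mul (hκ i hi).aestronglyMeasurable (Filter.Eventually.of_forall (hκM i hi))
    have hvab : IntervalIntegrable v volume a b :=
      (intervalIntegrable_iff_integrableOn_Ioo_of_le hab).2 hv
    simp only [Finset.sum_mul, mul_assoc]
    rw [integral_finsetSum _ fun i hi => (hκv i hi).const_mul (β i x)]
    refine Finset.sum_congr rfl fun i hi => ?_
    rw [hLκ i hi v hvab, intervalIntegral.integral_of_le hab, integral_Ioc_eq_integral_Ioo,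
      integral_const_mul, mul_comm]

/-! ### The univariate projections on an element -/

namespace OpenKnots

lemma knot_nonneg {p : ℕ} (Ξ : OpenKnots p) (i : ℕ) : 0 ≤ Ξ.knot i :=
  (Ξ.knot_start 0 (Nat.zero_le _)).ge.trans (Ξ.mono (Nat.zero_le i))

lemma knot_le_one {p : ℕ} (Ξ : OpenKnots p) (i : ℕ) : Ξ.knot i ≤ 1 :=
  (Ξ.mono (Nat.le_add_right i Ξ.n)).trans (Ξ.knot_end _ (Nat.le_add_left _ _)).le

lemma length_le_length_support {p m j : ℕ} (Ξ : OpenKnots p) (hj : j ∈ Finset.Icc (m - p) m) :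
    Ξ.knot (m + 1) - Ξ.knot m ≤ Ξ.knot (j + p + 1) - Ξ.knot j := by
  rw [Finset.mem_Icc] at hj
  exact sub_le_sub (Ξ.mono (by omega)) (Ξ.mono hj.2)

namespace IsElement

variable {p m j : ℕ} {Ξ : OpenKnots p} (hm : Ξ.IsElement m)
include hm

lemma le : p ≤ m := by
  by_contra! hmp
  exact hm.ne ((Ξ.knot_start m hmp.le).trans (Ξ.knot_start (m + 1) hmp).symm)

lemma lt : m < Ξ.n := by
  by_contra! hnm
  exact hm.ne ((Ξ.knot_end m hnm).trans (Ξ.knot_end (m + 1) (by omega)).symm)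

lemma support_nonempty (hj : j ∈ Finset.Icc (m - p) m) : Ξ.knot j < Ξ.knot (j + p + 1) :=
  sub_pos.1 ((sub_pos.2 hm).trans_le (Ξ.length_le_length_support hj))

lemma sum_mul_bspline_eq_sum_Icc (c : ℕ → ℝ) {x : ℝ}
    (hx : x ∈ Ioo (Ξ.knot m) (Ξ.knot (m + 1))) :
    ∑ j ∈ Finset.range Ξ.n, c j * bspline Ξ.knot p j x =
      ∑ j ∈ Finset.Icc (m - p) m, c j * bspline Ξ.knot p j x := by
  have hmn := hm.lt
  refine (Finset.sum_subset (fun j hj => ?_) fun j _ hj => ?_).symm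
  · rw [Finset.mem_Icc] at hj
    exact Finset.mem_range.2 (by omega)
  · rw [Finset.mem_Icc] at hj
    rcases lt_or_ge m j with hmj | hjm
    · rw [bspline_of_lt Ξ.mono (hx.2.trans_le (Ξ.mono hmj)), mul_zero]
    · rw [bspline_of_ge Ξ.mono ((Ξ.mono (by omega)).trans hx.1.le), mul_zero]

lemma iteratedDeriv_proj (w : ℝ → ℝ) (k : ℕ) {x : ℝ}
    (hx : x ∈ Ioo (Ξ.knot m) (Ξ.knot (m + 1))) :
    iteratedDeriv k (proj Ξ w) x = ∑ j ∈ Finset.Icc (m - p) m,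
      dualFunctional Ξ.knot p j w * iteratedDeriv k (bspline Ξ.knot p j) x := by
  have hloc : EqOn (proj Ξ w) (fun y => ∑ j ∈ Finset.Icc (m - p) m,
      dualFunctional Ξ.knot p j w * bspline Ξ.knot p j y) (Ioo (Ξ.knot m) (Ξ.knot (m + 1))) :=
    fun y hy => hm.sum_mul_bspline_eq_sum_Icc _ hy
  rw [hloc.iteratedDeriv_of_isOpen isOpen_Ioo k hx, iteratedDeriv_fun_sum fun j _ =>
    contDiffAt_const.mul (contDiffAt_bspline (notMem_range_of_mem_Ioo Ξ.mono hx) p j)]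
  simp only [iteratedDeriv_const_mul_field]

end IsElement

variable {p m : ℕ} {Ξ : OpenKnots p}

lemma IsRegular.sub_le {c : ℝ} (hc : Ξ.IsRegular c) (hm : Ξ.IsElement m) (i k : ℕ) :
    Ξ.knot (i + k) - Ξ.knot i ≤ k * (c * (Ξ.knot (m + 1) - Ξ.knot m)) := by
  induction k with
  | zero => simp
  | succ k ih =>
    have interval_le : Ξ.knot (i + k + 1) - Ξ.knot (i + k) ≤ c * (Ξ.knot (m + 1) - Ξ.knot m) := by
      by_cases hk : Ξ.IsElement (i + k)
      · exact hc m (i + k) hm hk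
      · exact (sub_nonpos.2 (not_lt.1 hk)).trans ((sub_pos.2 hm).le.trans (hc m m hm hm))
    push_cast
    rw [← add_assoc]
    linarith

end OpenKnots

/-- The univariate projections `Π_p`, `Π^{c,1}_{p-1}` and `Π^{c,2}_{p-2}`, indexed by the number of
derivatives that they commute with. -/
noncomputable def univProj {p : ℕ} (Ξ : OpenKnots p) : Fin 3 → (ℝ → ℝ) → ℝ → ℝ :=
  ![proj Ξ, projC1 Ξ, projC2 Ξ]

lemma univProj_eq_iteratedDeriv {p : ℕ} (Ξ : OpenKnots p) (k : Fin 3) (v : ℝ → ℝ) :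
    univProj Ξ k v = iteratedDeriv k (proj Ξ ((primitive 0)^[k] v)) := by
  fin_cases k
  · rfl
  · exact iteratedDeriv_one.symm
  · exact (iteratedDeriv_succ.trans (congrArg deriv iteratedDeriv_one)).symm

lemma exists_hasBoundedDensity_dualFunctional_element {p : ℕ} (hp : 1 ≤ p) :
    ∃ N : ℝ, 0 ≤ N ∧ ∀ (Ξ : OpenKnots p) (m : ℕ), Ξ.IsElement m → ∀ j ∈ Finset.Icc (m - p) m,
      HasBoundedDensity (dualFunctional Ξ.knot p j) (Ξ.knot (m - p)) (Ξ.knot (m + p + 1))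
        (N / (Ξ.knot (m + 1) - Ξ.knot m)) := by
  obtain ⟨N, hN, hdensity⟩ := exists_hasBoundedDensity_dualFunctional hp
  refine ⟨N, hN, fun Ξ m hm j hj => ?_⟩
  have hjm := Finset.mem_Icc.1 hj
  refine (hdensity Ξ.knot j _ _ Ξ.mono (hm.support_nonempty hj) (Ξ.mono hjm.1)
    (Ξ.mono (by omega))).mono ?_
  exact div_le_div_of_nonneg_left hN (sub_pos.2 hm) (Ξ.length_le_length_support hj)

section Element

variable {p m : ℕ} {Ξ : OpenKnots p} {w w' : ℝ → ℝ} {c d x : ℝ}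

lemma dualFunctional_add_affine {j : ℕ} (hp : 1 ≤ p) (hm : Ξ.IsElement m)
    (hj : j ∈ Finset.Icc (m - p) m)
    (hw : IntervalIntegrable w volume (Ξ.knot (m - p)) (Ξ.knot (m + p + 1)))
    (hw' : EqOn w' (fun s => w s + (d + c * s)) (uIcc (Ξ.knot (m - p)) (Ξ.knot (m + p + 1)))) :
    dualFunctional Ξ.knot p j w' =
      dualFunctional Ξ.knot p j w + (d + c * grevilleAbscissa Ξ.knot p j) := by
  obtain ⟨N, -, hdensity⟩ := exists_hasBoundedDensity_dualFunctional_element hp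
  have hL := hdensity Ξ m hm j hj
  have hξj := hm.support_nonempty hj
  have hconst : dualFunctional Ξ.knot p j (fun _ => d) = d := by
    simpa only [mul_one, dualFunctional_one hp hξj Ξ.mono] using
      hL.apply_const_mul (v := fun _ => 1) intervalIntegrable_const d
  have hid : IntervalIntegrable (fun s => s) volume (Ξ.knot (m - p)) (Ξ.knot (m + p + 1)) :=
    intervalIntegral.intervalIntegrable_id
  rw [hL.apply_congr (hw.add (intervalIntegrable_const.add (hid.const_mul c))) hw',
    hL.apply_add hw (intervalIntegrable_const.add (hid.const_mul c)),
    hL.apply_add intervalIntegrable_const (hid.const_mul c), hL.apply_const_mul hid, hconst,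
    dualFunctional_id hp hξj Ξ.mono]

lemma proj_add_affine (hp : 1 ≤ p) (hm : Ξ.IsElement m)
    (hw : IntervalIntegrable w volume (Ξ.knot (m - p)) (Ξ.knot (m + p + 1)))
    (hw' : EqOn w' (fun s => w s + (d + c * s)) (uIcc (Ξ.knot (m - p)) (Ξ.knot (m + p + 1))))
    (hx : x ∈ Ioo (Ξ.knot m) (Ξ.knot (m + 1))) : proj Ξ w' x = proj Ξ w x + (d + c * x) := by
  have hxIco := Ioo_subset_Ico_self hx
  have hp0 : (p : ℝ) ≠ 0 := by positivity
  have hone : ∑ j ∈ Finset.range Ξ.n, bspline Ξ.knot p j x = 1 :=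
    sum_bspline_eq_one Ξ.mono hxIco hm.lt hm.le
  have hgreville :
      ∑ j ∈ Finset.range Ξ.n, grevilleAbscissa Ξ.knot p j * bspline Ξ.knot p j x = x := by
    simp only [grevilleAbscissa, div_mul_eq_mul_div, ← Finset.sum_div]
    rw [sum_sum_knot_mul_bspline Ξ.mono hxIco hm.lt hm.le, mul_div_cancel_left₀ _ hp0]
  calc proj Ξ w' x
      = ∑ j ∈ Finset.Icc (m - p) m, (dualFunctional Ξ.knot p j w +
          (d + c * grevilleAbscissa Ξ.knot p j)) * bspline Ξ.knot p j x := by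
        rw [proj, hm.sum_mul_bspline_eq_sum_Icc _ hx]
        exact Finset.sum_congr rfl fun j hj => by rw [dualFunctional_add_affine hp hm hj hw hw']
    _ = proj Ξ w x + (d * ∑ j ∈ Finset.range Ξ.n, bspline Ξ.knot p j x +
          c * ∑ j ∈ Finset.range Ξ.n, grevilleAbscissa Ξ.knot p j * bspline Ξ.knot p j x) := by
        rw [← hm.sum_mul_bspline_eq_sum_Icc _ hx]
        simp only [proj, Finset.mul_sum, ← Finset.sum_add_distrib, add_mul, mul_assoc]
    _ = proj Ξ w x + (d + c * x) := by rw [hone, hgreville, mul_one]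

lemma iteratedDeriv_proj_add_affine (hp : 1 ≤ p) (hm : Ξ.IsElement m) (k : ℕ)
    (hw : IntervalIntegrable w volume (Ξ.knot (m - p)) (Ξ.knot (m + p + 1)))
    (hw' : EqOn w' (fun s => w s + (d + c * s)) (uIcc (Ξ.knot (m - p)) (Ξ.knot (m + p + 1))))
    (hx : x ∈ Ioo (Ξ.knot m) (Ξ.knot (m + 1))) :
    iteratedDeriv k (proj Ξ w') x =
      iteratedDeriv k (proj Ξ w) x + iteratedDeriv k (fun t => d + c * t) x := by
  have hloc : EqOn (proj Ξ w') (fun y => proj Ξ w y + (d + c * y))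
      (Ioo (Ξ.knot m) (Ξ.knot (m + 1))) := fun y hy => proj_add_affine hp hm hw hw' hy
  have hsmooth : ContDiffAt ℝ k (proj Ξ w) x := ContDiffAt.sum fun j _ =>
    contDiffAt_const.mul (contDiffAt_bspline (notMem_range_of_mem_Ioo Ξ.mono hx) p j)
  rw [hloc.iteratedDeriv_of_isOpen isOpen_Ioo k hx, iteratedDeriv_fun_add hsmooth (by fun_prop)]

lemma univProj_apply_eq_iteratedDeriv {v : ℝ → ℝ} (hp : 1 ≤ p) (hm : Ξ.IsElement m)
    (hv : IntegrableOn v (Ioo 0 1)) (k : Fin 3) (hx : x ∈ Ioo (Ξ.knot m) (Ξ.knot (m + 1))) :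
    univProj Ξ k v x = iteratedDeriv k (proj Ξ ((primitive (Ξ.knot (m - p)))^[k] v)) x := by
  have hmem : ∀ i, Ξ.knot i ∈ uIcc 0 1 := fun i => by
    rw [uIcc_of_le zero_le_one]
    exact ⟨Ξ.knot_nonneg i, Ξ.knot_le_one i⟩
  have hsub := uIcc_subset_uIcc (hmem (m - p)) (hmem (m + p + 1))
  have hv01 : IntervalIntegrable v volume 0 1 :=
    (intervalIntegrable_iff_integrableOn_Ioo_of_le zero_le_one).2 hv
  have hprim := intervalIntegrable_iterate_primitive (hv01.mono_set hsub)
  rw [univProj_eq_iteratedDeriv]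
  fin_cases k
  · simp
  · have hconst : EqOn (primitive 0 v) (fun s => primitive (Ξ.knot (m - p)) v s +
        (primitive 0 v (Ξ.knot (m - p)) + 0 * s))
        (uIcc (Ξ.knot (m - p)) (Ξ.knot (m + p + 1))) := fun s hs => by
      rw [primitive_eq_add_primitive hv01 (hmem _) (hsub hs)]
      ring
    have hderiv := iteratedDeriv_proj_add_affine hp hm 1 (hprim 1) hconst hx
    simpa [iteratedDeriv_one] using hderiv
  · have haffine := fun s (hs : s ∈ uIcc (Ξ.knot (m - p)) (Ξ.knot (m + p + 1))) =>
      primitive_primitive_eq_add_affine hv01 (hmem (m - p)) (hsub hs)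
    have hderiv := iteratedDeriv_proj_add_affine hp hm 2 (hprim 2) haffine hx
    simpa [iteratedDeriv_succ, iteratedDeriv_zero] using hderiv

end Element

lemma exists_isKernelOp_iteratedDeriv_proj {p : ℕ} (hp : 1 ≤ p) (cu : ℝ) (k : ℕ) :
    ∃ C : ℝ≥0, ∀ Ξ : OpenKnots p, Ξ.IsRegular cu → ∀ m, Ξ.IsElement m →
      IsKernelOp (fun v => iteratedDeriv k (proj Ξ ((primitive (Ξ.knot (m - p)))^[k] v)))
        (Ioo (Ξ.knot (m - p)) (Ξ.knot (m + p + 1))) (Ioo (Ξ.knot m) (Ξ.knot (m + 1)))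
        (Ioo (Ξ.knot (m - p)) (Ξ.knot (m + p + 1))) C := by
  obtain ⟨N, hN, hdensity⟩ := exists_hasBoundedDensity_dualFunctional_element hp
  refine ⟨((p + 1) * (N * (2 ^ p * (2 * p) ^ k)) * ((2 * p + 1) * cu) ^ (k + 1)).toNNReal,
    fun Ξ hcu m hm => ?_⟩
  have hpm : p ≤ m := hm.le
  have hab : Ξ.knot (m - p) ≤ Ξ.knot (m + p + 1) := Ξ.mono (by omega)
  have hh : 0 < Ξ.knot (m + 1) - Ξ.knot m := sub_pos.2 hm
  have hlength : (Ξ.knot (m + p + 1) - Ξ.knot (m - p)) / (Ξ.knot (m + 1) - Ξ.knot m) ≤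
      (2 * p + 1) * cu := by
    rw [div_le_iff₀ hh, mul_assoc]
    have := hcu.sub_le hm (m - p) (2 * p + 1)
    rw [show m - p + (2 * p + 1) = m + p + 1 by omega] at this
    exact_mod_cast this
  refine (isKernelOp_sum (Finset.Icc (m - p) m) (fun j hj =>
      (hdensity Ξ m hm j hj).comp_iterate_primitive hab k)
    (fun j _ => measurable_iteratedDeriv_bspline Ξ.knot k p j)
    (fun j _ x hx => abs_iteratedDeriv_bspline_le Ξ.mono hx k p j) hab
    (Ioo_subset_Ioo (Ξ.mono (by omega)) (Ξ.mono (by omega)))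
    (le_trans ?_ (Real.le_coe_toNNReal _))).congr subset_rfl
    fun v _ x hx => hm.iteratedDeriv_proj _ k hx
  rw [Nat.card_Icc, show m + 1 - (m - p) = p + 1 by omega]
  set ℓ := Ξ.knot (m + p + 1) - Ξ.knot (m - p)
  set h := Ξ.knot (m + 1) - Ξ.knot m
  calc ((p + 1 : ℕ) : ℝ) * (N / h * ℓ ^ k * (2 ^ p * (2 * p / h) ^ k)) * ℓ
      = (p + 1) * (N * (2 ^ p * (2 * p) ^ k)) * (ℓ / h) ^ (k + 1) := by
        rw [pow_succ (ℓ / h), div_pow, div_pow]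
        push_cast
        field_simp
    _ ≤ (p + 1) * (N * (2 ^ p * (2 * p) ^ k)) * ((2 * p + 1) * cu) ^ (k + 1) := by
        have : 0 ≤ ℓ / h := div_nonneg (sub_nonneg.2 hab) hh.le
        gcongr

/-- On an element, the univariate projections factor through iterated primitives from the left end
of the support extension: those starting at `0` differ by affine functions, which `proj`
reproduces. -/
lemma exists_isKernelOp_univProj {p : ℕ} (hp : 1 ≤ p) (cu : ℝ) :
    ∃ C : ℝ≥0, ∀ Ξ : OpenKnots p, Ξ.IsRegular cu → ∀ m, Ξ.IsElement m → ∀ k,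
      IsKernelOp (univProj Ξ k) (Ioo 0 1) (Ioo (Ξ.knot m) (Ξ.knot (m + 1)))
        (Ioo (Ξ.knot (m - p)) (Ξ.knot (m + p + 1))) C := by
  choose C hC using fun k : Fin 3 => exists_isKernelOp_iteratedDeriv_proj hp cu k
  exact ⟨∑ k, C k, fun Ξ hcu m hm k => ((hC k Ξ hcu m hm).congr
    (Ioo_subset_Ioo (Ξ.knot_nonneg _) (Ξ.knot_le_one _))
    fun v hv x hx => univProj_apply_eq_iteratedDeriv hp hm hv k hx).mono
      (Finset.single_le_sum (fun _ _ => zero_le) (Finset.mem_univ k))⟩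

/-! ### Tensor products on boxes -/

lemma measurePreserving_piFinSuccAbove_box {n : ℕ} (s : Fin (n + 1) → Set ℝ) (l : Fin (n + 1))
    (A : Set ℝ) : MeasurePreserving (MeasurableEquiv.piFinSuccAbove (fun _ => ℝ) l)
      (volume.restrict (univ.pi (Function.update s l A)))
      ((volume.restrict A).prod (Measure.pi fun i => volume.restrict (s (l.succAbove i)))) := by
  have hpres := measurePreserving_piFinSuccAbove
    (fun i => (volume : Measure ℝ).restrict (Function.update s l A i)) l
  rw [← Measure.restrict_pi_pi, ← volume_pi] at hpres
  simpa only [Function.update_self, Function.update_of_ne (Fin.succAbove_ne l _)] using hpres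

lemma IsKernelOp.memL2_actOn {T : (ℝ → ℝ) → ℝ → ℝ} {U I J : Set ℝ} {C : ℝ≥0}
    (hT : IsKernelOp T U I J C) (hI : MeasurableSet I) (hU : volume U ≠ ∞) (hJU : J ⊆ U)
    (l : Fin 3) {s : Fin 3 → Set ℝ} (hs : ∀ i, volume (s i) ≠ ∞) {f : (Fin 3 → ℝ) → ℝ}
    (hf : MemL2 (univ.pi (Function.update s l U)) f) :
    MemL2 (univ.pi (Function.update s l I)) (actOn l T f) ∧
      normL2 (univ.pi (Function.update s l I)) (actOn l T f) ≤
        C * normL2 (univ.pi (Function.update s l J)) f := by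
  have : ∀ i, IsFiniteMeasure ((volume : Measure ℝ).restrict (s i)) := fun i =>
    isFiniteMeasure_restrict.2 (hs i)
  set e := MeasurableEquiv.piFinSuccAbove (fun _ : Fin 3 => ℝ) l
  have hmap : ∀ A, volume.restrict (univ.pi (Function.update s l A)) = Measure.map e.symm
      ((volume.restrict A).prod (Measure.pi fun i => volume.restrict (s (l.succAbove i)))) :=
    fun A => ((measurePreserving_piFinSuccAbove_box s l A).symm e).map_eq.symm
  have hemb : MeasurableEmbedding e.symm := e.symm.measurableEmbedding
  have he : ∀ z, e.symm z = Fin.insertNth (α := fun _ => ℝ) l z.1 z.2 := fun _ => rfl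
  have hact : actOn l T f ∘ e.symm = fun z => T (fun t => (f ∘ e.symm) (t, z.2)) z.1 := by
    funext z
    simp only [Function.comp_apply, actOn, he, Fin.insertNth_apply_same, Fin.update_insertNth]
  unfold MemL2 normL2 at *
  rw [hmap, hemb.memLp_map_measure_iff] at hf
  rw [hmap, hmap, hemb.memLp_map_measure_iff, hemb.eLpNorm_map_measure,
    hemb.eLpNorm_map_measure, hact]
  exact hT.memLp_prod hI hU hJU hf

/-- Local stability in the coordinates `l ∈ A`: on boxes whose other sides are arbitrary subsets of
`U`, the operator `G` maps `L²` functions to `L²` functions, and its norm over the sides `I l` is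
controlled by the norm of the argument over the sides `J l`. -/
def IsStableOnBoxes (G : ((Fin 3 → ℝ) → ℝ) → (Fin 3 → ℝ) → ℝ) (A : Finset (Fin 3)) (U : Set ℝ)
    (I J : Fin 3 → Set ℝ) (C : ℝ≥0) : Prop :=
  ∀ s : Fin 3 → Set ℝ, (∀ i, s i ⊆ U) → ∀ f, MemL2 (univ.pi (A.piecewise (fun _ => U) s)) f →
    MemL2 (univ.pi (A.piecewise I s)) (G f) ∧
      normL2 (univ.pi (A.piecewise I s)) (G f) ≤ C * normL2 (univ.pi (A.piecewise J s)) f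

namespace IsStableOnBoxes

variable {G : ((Fin 3 → ℝ) → ℝ) → (Fin 3 → ℝ) → ℝ} {A : Finset (Fin 3)} {U : Set ℝ}
  {I J : Fin 3 → Set ℝ} {C C' : ℝ≥0}

lemma id_empty : IsStableOnBoxes id ∅ U I J 1 := fun s _ f hf => by
  simp only [Finset.piecewise_empty, id, ENNReal.coe_one, one_mul] at hf ⊢
  exact ⟨hf, le_rfl⟩

lemma actOn_insert (hG : IsStableOnBoxes G A U I J C) {l : Fin 3} (hl : l ∉ A)
    {T : (ℝ → ℝ) → ℝ → ℝ} (hT : IsKernelOp T U (I l) (J l) C') (hI : MeasurableSet (I l))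
    (hU : volume U ≠ ∞) (hIU : ∀ i, I i ⊆ U) (hJU : J l ⊆ U) :
    IsStableOnBoxes (fun f => actOn l T (G f)) (insert l A) U I J (C' * C) := by
  intro s hs f hf
  have hupdate : ∀ {V : Set ℝ}, V ⊆ U → ∀ i, Function.update s l V i ⊆ U := fun {V} hV =>
    (Function.forall_update_iff s fun _ t => t ⊆ U).2 ⟨hV, fun i _ => hs i⟩
  have hbox : ∀ i, A.piecewise I s i ⊆ U := fun i => by
    rw [Finset.piecewise]
    split_ifs
    exacts [hIU i, hs i]
  simp only [Finset.piecewise_insert] at hf ⊢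
  have hfJ : MemL2 (univ.pi (A.piecewise (fun _ => U) (Function.update s l (J l)))) f := by
    rw [← Finset.update_piecewise_of_notMem _ _ _ hl]
    have hle : Function.update (A.piecewise (fun _ => U) s) l (J l) ≤
        Function.update (A.piecewise (fun _ => U) s) l U := Function.update_mono hJU
    exact hf.mono_measure (Measure.restrict_mono (pi_mono fun i _ => hle i) le_rfl)
  rw [Finset.update_piecewise_of_notMem _ _ _ hl] at hf
  obtain ⟨hGU, -⟩ := hG _ (hupdate subset_rfl) f hf
  obtain ⟨-, hGJ⟩ := hG _ (hupdate hJU) f hfJ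
  rw [← Finset.update_piecewise_of_notMem _ _ _ hl] at hGU
  obtain ⟨hmem, hle⟩ := hT.memL2_actOn hI hU hJU l
    (fun i => measure_ne_top_of_subset (hbox i) hU) hGU
  refine ⟨hmem, hle.trans ?_⟩
  rw [Finset.update_piecewise_of_notMem _ _ _ hl, Finset.update_piecewise_of_notMem _ _ _ hl,
    ENNReal.coe_mul, mul_assoc]
  gcongr

end IsStableOnBoxes

lemma isStableOnBoxes_tensor {T : Fin 3 → (ℝ → ℝ) → ℝ → ℝ} {U : Set ℝ} {I J : Fin 3 → Set ℝ}
    {C : ℝ≥0} (hT : ∀ l, IsKernelOp (T l) U (I l) (J l) C) (hI : ∀ l, MeasurableSet (I l))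
    (hU : volume U ≠ ∞) (hIU : ∀ l, I l ⊆ U) (hJU : ∀ l, J l ⊆ U) :
    IsStableOnBoxes (tensor (T 0) (T 1) (T 2)) Finset.univ U I J (C ^ 3) := by
  have h₂ := IsStableOnBoxes.id_empty.actOn_insert (Finset.notMem_empty 2) (hT 2) (hI 2) hU hIU
    (hJU 2)
  have h₁ := h₂.actOn_insert (l := 1) (by decide) (hT 1) (hI 1) hU hIU (hJU 1)
  have h₀ := h₁.actOn_insert (l := 0) (by decide) (hT 0) (hI 0) hU hIU (hJU 0)
  rwa [show C * (C * (C * 1)) = C ^ 3 by ring,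
    show insert 0 (insert 1 (insert 2 ∅)) = (Finset.univ : Finset (Fin 3)) from rfl] at h₀

/-- The projection `Π_{α₀ α₁ α₂}` on the parametric domain. -/
noncomputable def tensorProj {p : Fin 3 → ℕ} (Ξ : ∀ l, OpenKnots (p l)) (α : Fin 3 → Fin 3) :
    ((Fin 3 → ℝ) → ℝ) → (Fin 3 → ℝ) → ℝ :=
  tensor (univProj (Ξ 0) (α 0)) (univProj (Ξ 1) (α 1)) (univProj (Ξ 2) (α 2))

section TensorProj

variable {p : Fin 3 → ℕ} (Ξ : ∀ l, OpenKnots (p l))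

lemma proj2_entry_eq_tensorProj (S : (Fin 3 → ℝ) → Matrix (Fin 3) (Fin 3) ℝ) (a b : Fin 3) :
    (fun x => proj2 Ξ S x a b) =
      tensorProj Ξ (Pi.single a 1 + Pi.single b 1) fun x => S x (min a b) (max a b) := by
  fin_cases a <;> fin_cases b <;> rfl

lemma proj3_entry_eq_tensorProj (T : (Fin 3 → ℝ) → Matrix (Fin 3) (Fin 3) ℝ) (a b : Fin 3) :
    (fun x => proj3 Ξ T x a b) =
      tensorProj Ξ (1 + Pi.single a 1 - Pi.single b 1) fun x => T x a b := by
  fin_cases a <;> fin_cases b <;> rfl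

lemma proj4_entry_eq_tensorProj (v : (Fin 3 → ℝ) → Fin 3 → ℝ) (a : Fin 3) :
    (fun x => proj4 Ξ v x a) = tensorProj Ξ (1 + Pi.single a 1) fun x => v x a := by
  fin_cases a <;> rfl

end TensorProj

lemma exists_normL2_tensorProj_le {p : Fin 3 → ℕ} (hp : ∀ l, 1 ≤ p l) (cu : ℝ) :
    ∃ C : ℝ≥0, ∀ Ξ : ∀ l, OpenKnots (p l), (∀ l, (Ξ l).IsRegular cu) →
      ∀ j : Fin 3 → ℕ, (∀ l, (Ξ l).IsElement (j l)) → ∀ α f, MemL2 cube f →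
        MemL2 (element Ξ j) (tensorProj Ξ α f) ∧
          normL2 (element Ξ j) (tensorProj Ξ α f) ≤ C * normL2 (extension Ξ j) f := by
  choose C hC using fun l => exists_isKernelOp_univProj (hp l) cu
  refine ⟨(∑ l, C l) ^ 3, fun Ξ hcu j hj α f hf => ?_⟩
  have hsub : ∀ l i k, Ioo ((Ξ l).knot i) ((Ξ l).knot k) ⊆ Ioo 0 1 := fun l i k =>
    Ioo_subset_Ioo ((Ξ l).knot_nonneg i) ((Ξ l).knot_le_one k)
  have hstable := isStableOnBoxes_tensor (T := fun l => univProj (Ξ l) (α l))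
    (fun l => (hC l (Ξ l) (hcu l) (j l) (hj l) (α l)).mono
      (Finset.single_le_sum (fun _ _ => zero_le) (Finset.mem_univ l)))
    (fun _ => measurableSet_Ioo) measure_Ioo_lt_top.ne (fun l => hsub l _ _) (fun l => hsub l _ _)
    (fun _ => Ioo 0 1) (fun _ => subset_rfl) f
  simp only [Finset.piecewise_univ] at hstable
  exact hstable hf

/-! ### Norms of matrix and vector functions -/

lemma rpow_half_sum_sq_le {ι : Type*} [Fintype ι] {x y : ι → ℝ≥0∞} {C : ℝ≥0∞}
    (h : ∀ i, ∃ k, x i ≤ C * y k) : (∑ i, x i ^ 2) ^ (1 / 2 : ℝ) ≤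
      Fintype.card ι * C * (∑ k, y k ^ 2) ^ (1 / 2 : ℝ) := by
  set Y := (∑ k, y k ^ 2) ^ (1 / 2 : ℝ) with hY
  have hyY : ∀ k, y k ≤ Y := fun k => by
    rw [← sq_rpow_half (y k), hY]
    gcongr
    exact Finset.single_le_sum (f := fun k => y k ^ 2) (fun _ _ => zero_le) (Finset.mem_univ k)
  have hxY : ∀ i, x i ≤ C * Y := fun i => by
    obtain ⟨k, hk⟩ := h i
    exact hk.trans (by gcongr; exact hyY k)
  rw [← sq_rpow_half (_ * Y)]
  gcongr
  calc ∑ i, x i ^ 2 ≤ ∑ _i : ι, (C * Y) ^ 2 := by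
        gcongr with i
        exact hxY i
    _ = Fintype.card ι * (C * Y) ^ 2 := by
        rw [Finset.sum_const, Finset.card_univ, nsmul_eq_mul]
    _ ≤ (Fintype.card ι : ℝ≥0∞) ^ 2 * (C * Y) ^ 2 := by
        gcongr
        exact_mod_cast Nat.le_self_pow two_ne_zero (Fintype.card ι)
    _ = (Fintype.card ι * C * Y) ^ 2 := by ring

lemma matNormL2_le {D E : Set (Fin 3 → ℝ)} {M N : (Fin 3 → ℝ) → Matrix (Fin 3) (Fin 3) ℝ}
    {C : ℝ≥0∞}
    (h : ∀ a b, ∃ c d, normL2 D (fun x => M x a b) ≤ C * normL2 E (fun x => N x c d)) :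
    matNormL2 D M ≤ 9 * C * matNormL2 E N := by
  unfold matNormL2
  simpa [← Fintype.sum_prod_type'] using
    rpow_half_sum_sq_le (ι := Fin 3 × Fin 3) (x := fun i => normL2 D (fun x => M x i.1 i.2))
      (y := fun i => normL2 E (fun x => N x i.1 i.2)) fun i =>
        let ⟨c, d, hcd⟩ := h i.1 i.2
        ⟨(c, d), hcd⟩

lemma vecNormL2_le {D E : Set (Fin 3 → ℝ)} {v w : (Fin 3 → ℝ) → Fin 3 → ℝ} {C : ℝ≥0∞}
    (h : ∀ a, normL2 D (fun x => v x a) ≤ C * normL2 E (fun x => w x a)) :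
    vecNormL2 D v ≤ 3 * C * vecNormL2 E w := by
  simpa only [vecNormL2, Fintype.card_fin, Nat.cast_ofNat] using
    rpow_half_sum_sq_le fun a => ⟨a, h a⟩

end SplineHessian

theorem mainTheorem6_general (p : Fin 3 → ℕ) (hp : ∀ l, 1 ≤ p l) (cu : ℝ) :
    ∃ C : ℝ≥0, ∀ Ξ : ∀ l, OpenKnots (p l),
      (∀ l, (Ξ l).IsRegular cu) →
      ∀ j : Fin 3 → ℕ, (∀ l, (Ξ l).IsElement (j l)) →
        (∀ φ : (Fin 3 → ℝ) → ℝ, MemL2 cube φ →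
          MemL2 (element Ξ j) (proj1 Ξ φ) ∧
          normL2 (element Ξ j) (proj1 Ξ φ) ≤ C * normL2 (extension Ξ j) φ) ∧
        (∀ S : (Fin 3 → ℝ) → Matrix (Fin 3) (Fin 3) ℝ,
          (∀ a b, MemL2 cube (fun x => S x a b)) →
          (∀ a b, MemL2 (element Ξ j) (fun x => proj2 Ξ S x a b)) ∧
          matNormL2 (element Ξ j) (proj2 Ξ S) ≤ C * matNormL2 (extension Ξ j) S) ∧
        (∀ T : (Fin 3 → ℝ) → Matrix (Fin 3) (Fin 3) ℝ,
          (∀ a b, MemL2 cube (fun x => T x a b)) →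
          (∀ a b, MemL2 (element Ξ j) (fun x => proj3 Ξ T x a b)) ∧
          matNormL2 (element Ξ j) (proj3 Ξ T) ≤ C * matNormL2 (extension Ξ j) T) ∧
        (∀ v : (Fin 3 → ℝ) → Fin 3 → ℝ, (∀ a, MemL2 cube (fun x => v x a)) →
          (∀ a, MemL2 (element Ξ j) (fun x => proj4 Ξ v x a)) ∧
          vecNormL2 (element Ξ j) (proj4 Ξ v) ≤ C * vecNormL2 (extension Ξ j) v) := by
  obtain ⟨C, hC⟩ := exists_normL2_tensorProj_le hp cu
  refine ⟨9 * C, fun Ξ hcu j hj => ⟨fun φ hφ => ?_, fun S hS => ?_, fun T hT => ?_, fun v hv => ?_⟩⟩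
  all_goals rw [ENNReal.coe_mul]
  · obtain ⟨hmem, hle⟩ := hC Ξ hcu j hj 0 φ hφ
    refine ⟨hmem, hle.trans ?_⟩
    gcongr
    exact le_mul_of_one_le_left zero_le (by norm_num)
  · have hentry a b := hC Ξ hcu j hj (Pi.single a 1 + Pi.single b 1) _ (hS (min a b) (max a b))
    simp only [← proj2_entry_eq_tensorProj] at hentry
    exact ⟨fun a b => (hentry a b).1, matNormL2_le fun a b => ⟨_, _, (hentry a b).2⟩⟩
  · have hentry a b := hC Ξ hcu j hj (1 + Pi.single a 1 - Pi.single b 1) _ (hT a b)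
    simp only [← proj3_entry_eq_tensorProj] at hentry
    exact ⟨fun a b => (hentry a b).1, matNormL2_le fun a b => ⟨_, _, (hentry a b).2⟩⟩
  · have hentry a := hC Ξ hcu j hj (1 + Pi.single a 1) _ (hv a)
    simp only [← proj4_entry_eq_tensorProj] at hentry
    refine ⟨fun a => (hentry a).1, (vecNormL2_le fun a => (hentry a).2).trans ?_⟩
    gcongr
    norm_num

theorem mainTheorem6 (p r : Fin 3 → ℕ) (hp : ∀ l, 2 ≤ p l) (hr : ∀ l, 1 ≤ r l)
    (hrp : ∀ l, r l < p l) (cu : ℝ) :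
    ∃ C : ℝ≥0, ∀ Ξ : ∀ l, OpenKnots (p l),
      (∀ l, (Ξ l).HasRegularity (r l)) → (∀ l, (Ξ l).IsRegular cu) →
      ∀ j : Fin 3 → ℕ, (∀ l, (Ξ l).IsElement (j l)) →
        (∀ φ : (Fin 3 → ℝ) → ℝ, MemL2 cube φ →
          MemL2 (element Ξ j) (proj1 Ξ φ) ∧
          normL2 (element Ξ j) (proj1 Ξ φ) ≤ C * normL2 (extension Ξ j) φ) ∧
        (∀ S : (Fin 3 → ℝ) → Matrix (Fin 3) (Fin 3) ℝ,
          (∀ a b, MemL2 cube (fun x => S x a b)) →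
          (∀ a b, MemL2 (element Ξ j) (fun x => proj2 Ξ S x a b)) ∧
          matNormL2 (element Ξ j) (proj2 Ξ S) ≤ C * matNormL2 (extension Ξ j) S) ∧
        (∀ T : (Fin 3 → ℝ) → Matrix (Fin 3) (Fin 3) ℝ,
          (∀ a b, MemL2 cube (fun x => T x a b)) →
          (∀ a b, MemL2 (element Ξ j) (fun x => proj3 Ξ T x a b)) ∧
          matNormL2 (element Ξ j) (proj3 Ξ T) ≤ C * matNormL2 (extension Ξ j) T) ∧
        (∀ v : (Fin 3 → ℝ) → Fin 3 → ℝ, (∀ a, MemL2 cube (fun x => v x a)) →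
          (∀ a, MemL2 (element Ξ j) (fun x => proj4 Ξ v x a)) ∧
          vecNormL2 (element Ξ j) (proj4 Ξ v) ≤ C * vecNormL2 (extension Ξ j) v) := by
  obtain ⟨C, hC⟩ := mainTheorem6_general p (fun l => one_le_two.trans (hp l)) cu
  exact ⟨C, fun Ξ _ => hC Ξ⟩
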